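/- Let $\Omega=(0,1)^2$ with sides $\Gamma_1=(0,1)\times\{0\}$, $\Gamma_2=\{1\}\times(0,1)$, $\Gamma_3=(0,1)\times\{1\}$, $\Gamma_4=\{0\}\times(0,1)$ and outward unit normal $\nu$. Let $k>0$, let each of $\mathcal B_1,\mathcal B_3$ be either $u\mapsto u$ or $u\mapsto\frac{\partial u}{\partial\nu}$, let $\mathcal B_2$ be one of $u\mapsto u$, $u\mapsto\frac{\partial u}{\partial\nu}$, $u\mapsto\frac{\partial u}{\partial\nu}-iku$, let $\mathcal B_4u=\frac{\partial u}{\partial\nu}-iku$, and let $g_4\in L^2(\Gamma_4)$ be complex valued. Then the boundary value problem $$\Delta u+k^2u=0\ \text{ in }\Omega,\qquad \mathcal B_ju=0\ \text{ on }\Gamma_j\ (j=1,2,3),\qquad \mathcal B_4u=g_4\ \text{ on }\Gamma_4$$ has a unique weak solution $u$, and it satisfies $$\|\nabla u\|_{L^2(\Omega)}+k\,\|u\|_{L^2(\Omega)}\le\sqrt{12}\,\max\{k,1\}\,\|g_4\|_{L^2(\Gamma_4)}.$$ Here a weak solution is a complex-valued $u\in\mathcal H$, where $\mathcal H$ is the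 set of $v\in H^1(\Omega)$ whose trace vanishes on every side $\Gamma_j$ with $\mathcal B_j=\mathrm{id}$, such that, with $\Gamma_R$ the union of the sides carrying an impedance condition, $$\int_\Omega\bigl(\nabla u\cdot\nabla\overline v-k^2u\overline v\bigr)-ik\int_{\Gamma_R}u\overline v=\int_{\Gamma_4}g_4\overline v\qquad\text{for all }v\in\mathcal H.$$ -/

import Mathlib

open MeasureTheory Set Filter Topology
open scoped ContDiff ComplexConjugate

/-- The unit square `Ω = (0,1) × (0,1)`. -/
def unitSquare : Set (ℝ × ℝ) := Ioo 0 1 ×ˢ Ioo 0 1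

/-- Lebesgue measure on `Ω`. -/
noncomputable def squareMeasure : Measure (ℝ × ℝ) := volume.restrict unitSquare

/-- Lebesgue (arc length) measure on a side of `Ω`, parametrised by `(0,1)`. -/
noncomputable def sideMeasure : Measure ℝ := volume.restrict (Ioo 0 1)

/-- The four open sides of `Ω`, in the order `Γ₁`, `Γ₂`, `Γ₃`, `Γ₄`. -/
inductive Side
  | bottom
  | right
  | top
  | left
  deriving DecidableEq

instance : Fintype Side := ⟨{.bottom, .right, .top, .left}, by intro s; cases s <;> simp⟩

/-- The parametrisation of a side by `(0,1)`:
`Γ₁ = (0,1) × {0}`, `Γ₂ = {1} × (0,1)`, `Γ₃ = (0,1) × {1}`, `Γ₄ = {0} × (0,1)`. -/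
def Side.point : Side → ℝ → ℝ × ℝ
  | .bottom, s => (s, 0)
  | .right, s => (1, s)
  | .top, s => (s, 1)
  | .left, s => (0, s)

/-- The boundary operators `u`, `∂u/∂ν` and `∂u/∂ν - i k u`. -/
inductive BoundaryOperator
  | dirichlet
  | neumann
  | impedance
  deriving DecidableEq

/-- `ux` and `uy` are the weak first partial derivatives of `u` on `Ω`: integration by parts
holds against every smooth `φ` with compact support in `Ω`. -/
def HasWeakGradient (u ux uy : ℝ × ℝ → ℂ) : Prop :=
  ∀ φ : ℝ × ℝ → ℂ, ContDiff ℝ ∞ φ → HasCompactSupport φ → tsupport φ ⊆ unitSquare →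
    (∫ z, u z * fderiv ℝ φ z (1, 0) ∂squareMeasure = -∫ z, ux z * φ z ∂squareMeasure) ∧
    (∫ z, u z * fderiv ℝ φ z (0, 1) ∂squareMeasure = -∫ z, uy z * φ z ∂squareMeasure)

/-- `u ∈ H¹(Ω)` (complex valued) with weak gradient `(ux, uy)`. -/
structure MemH1 (u ux uy : ℝ × ℝ → ℂ) : Prop where
  memLp : MemLp u 2 squareMeasure
  memLp_x : MemLp ux 2 squareMeasure
  memLp_y : MemLp uy 2 squareMeasure
  weakGradient : HasWeakGradient u ux uy

/-- `t ∈ L²` is the trace on the side `s` of the function `u ∈ H¹(Ω)` with weak gradient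
`(ux, uy)`. The trace operator is the continuous extension of restriction to the boundary from
functions smooth up to the boundary: some sequence of smooth functions converges to `u` in
`H¹(Ω)` while its restrictions to `s` converge to `t` in `L²`. -/
def HasTrace (u ux uy : ℝ × ℝ → ℂ) (s : Side) (t : ℝ → ℂ) : Prop :=
  MemLp t 2 sideMeasure ∧
  ∃ φ : ℕ → ℝ × ℝ → ℂ, (∀ n, ContDiff ℝ ∞ (φ n)) ∧
    Tendsto (fun n => eLpNorm (fun z => φ n z - u z) 2 squareMeasure) atTop (𝓝 0) ∧
    Tendsto (fun n => eLpNorm (fun z => fderiv ℝ (φ n) z (1, 0) - ux z) 2 squareMeasure)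
      atTop (𝓝 0) ∧
    Tendsto (fun n => eLpNorm (fun z => fderiv ℝ (φ n) z (0, 1) - uy z) 2 squareMeasure)
      atTop (𝓝 0) ∧
    Tendsto (fun n => eLpNorm (fun y => φ n (s.point y) - t y) 2 sideMeasure) atTop (𝓝 0)

/-- `u ∈ H¹(Ω)`, with weak gradient `(ux, uy)`, is a weak solution of `Δu + k² u = -f` in `Ω`
with `B s u = g s` on every side `s`. Dirichlet conditions are imposed on the traces, and test
functions `v ∈ H¹(Ω)` have zero trace on the Dirichlet sides; Neumann and impedance conditions
are natural. -/
def IsHelmholtzSolution (k : ℝ) (B : Side → BoundaryOperator) (f : ℝ × ℝ → ℂ)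
    (g : Side → ℝ → ℂ) (u ux uy : ℝ × ℝ → ℂ) : Prop :=
  MemH1 u ux uy ∧
  ∃ t : Side → ℝ → ℂ, (∀ s, HasTrace u ux uy s (t s)) ∧
    (∀ s, B s = .dirichlet → t s =ᵐ[sideMeasure] g s) ∧
    ∀ (v vx vy : ℝ × ℝ → ℂ) (τ : Side → ℝ → ℂ), MemH1 v vx vy →
      (∀ s, HasTrace v vx vy s (τ s)) →
      (∀ s, B s = .dirichlet → τ s =ᵐ[sideMeasure] 0) →
      (∫ z, (ux z * conj (vx z) + uy z * conj (vy z) - (k : ℂ) ^ 2 * u z * conj (v z))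
          ∂squareMeasure)
        - Complex.I * k *
          (∑ s, if B s = .impedance then ∫ y, t s y * conj (τ s y) ∂sideMeasure else 0)
      = (∫ z, f z * conj (v z) ∂squareMeasure)
        + ∑ s, if B s = .dirichlet then 0 else ∫ y, g s y * conj (τ s y) ∂sideMeasure

/-- Boundary data equal to `g₄` on `Γ₄` and zero on the other three sides. -/
def leftData (g₄ : ℝ → ℂ) : Side → ℝ → ℂ
  | .left => g₄
  | _ => 0

/-! The proof is separation of variables. The transverse eigenfunctions for the conditions on `Γ₁`
and `Γ₃` are `φ_n(y) = sin (α_n y + θ)` (`exists_isModeFamily`). A product `v(x) φ_n(y)` solves the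
Helmholtz equation exactly when `v'' = (l - k²) v` with `l = α_n²`. The axial factor inherits the
condition of `Γ₂` at `x = 1` and the impedance condition at `x = 0`.

Everything quantitative is a one-dimensional estimate, uniform in `l`: if `G = |v'(0) + ikv(0)|`,
then `∫ |v'|² + (l + k²)|v|² ≤ 6 max(k,1)² G²` (`IsModeSolution.integral_energy_le`). The flux
`Im(v̄ v')` is constant in `x` and nonnegative at `x = 1`, so expanding `G²` gives `|v'(0)|² +
k²|v(0)|² ≤ G²`. For `l ≤ k²` the energy `|v'|² + (k² - l)|v|²` is conserved. For `l > k²` the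
function `Re(v̄ v')` increases to `0` at `x = 1`, so `|v|²` decreases and the energy integral is
`-Re(v̄ v')(0)`. Orthogonality of the `φ_n` and of the `φ_n'` sums the modes (`modeSum_stability`):
`‖∇u‖² + k²‖u‖² ≤ 6 max(k,1)² ‖g‖²`. Finally `(a + b)² ≤ 2(a² + b²)` turns `6` into `12`.

Existence (`exists_helmholtzSolution_le`): finite sums of the `φ_n` are dense in `L²(0,1)`. The
energy bound, with a trace inequality for the sides, makes the corresponding mode sums converge in
`H¹` together with their traces, and the weak formulation passes to the limit.

Uniqueness is by duality. Any weak solution is tested with the conjugate of `V(x) φ_n(y)`, where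
`V'' = (l - k²) V - e^{sx}` with homogeneous boundary conditions. This expresses `∫ u e^{sx} φ_n`
through `g` alone (`IsHelmholtzSolution.integral_mul_separated`). The functions `e^{sx} φ_n(y)`, `s
= 1 + j + i`, are total by Stone–Weierstrass (`IsModeFamily.ae_eq_zero`). Since `s²` is never real,
no resonance with `l - k²` occurs. -/

/-! ### Square-integrable functions on a side and on the square -/

section L2

variable {α : Type*} [MeasurableSpace α] {μ : Measure α}

theorem eLpNorm_two_eq_ofReal_sqrt {f : α → ℂ} (hf : MemLp f 2 μ) :
    eLpNorm f 2 μ = ENNReal.ofReal √(∫ x, ‖f x‖ ^ 2 ∂μ) := by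
  rw [hf.eLpNorm_eq_integral_rpow_norm (by norm_num) (by norm_num), Real.sqrt_eq_rpow]
  simp

theorem norm_integral_mul_le {f g : α → ℂ} (hf : MemLp f 2 μ) (hg : MemLp g 2 μ) :
    ‖∫ x, f x * g x ∂μ‖ ≤ √(∫ x, ‖f x‖ ^ 2 ∂μ) * √(∫ x, ‖g x‖ ^ 2 ∂μ) := by
  refine (norm_integral_le_integral_norm _).trans ?_
  simp only [norm_mul]
  refine (integral_mul_norm_le_Lp_mul_Lq Real.HolderConjugate.two_two
    (by simpa using hf) (by simpa using hg)).trans ?_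
  simp [Real.sqrt_eq_rpow]

theorem MeasureTheory.MemLp.integrable_mul_two {f g : α → ℂ} (hf : MemLp f 2 μ)
    (hg : MemLp g 2 μ) : Integrable (fun x => f x * g x) μ :=
  hf.integrable_mul hg

theorem tendsto_sqrt_integral_norm_sq {f : ℕ → α → ℂ} {g : α → ℂ} (hf : ∀ n, MemLp (f n) 2 μ)
    (hg : MemLp g 2 μ) (h : Tendsto (fun n => eLpNorm (fun x => f n x - g x) 2 μ) atTop (𝓝 0)) :
    Tendsto (fun n => √(∫ x, ‖f n x - g x‖ ^ 2 ∂μ)) atTop (𝓝 0) := by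
  have h1 := (ENNReal.tendsto_toReal (by simp : (0 : ENNReal) ≠ ⊤)).comp h
  refine h1.congr fun n => ?_
  have : eLpNorm (fun x => f n x - g x) 2 μ = _ := eLpNorm_two_eq_ofReal_sqrt ((hf n).sub hg)
  simp [this, Real.sqrt_nonneg]

theorem sqrt_integral_norm_sq_le_add {a b : α → ℂ} (ha : MemLp a 2 μ) (hb : MemLp b 2 μ) :
    √(∫ x, ‖a x‖ ^ 2 ∂μ) ≤ √(∫ x, ‖b x‖ ^ 2 ∂μ) + √(∫ x, ‖a x - b x‖ ^ 2 ∂μ) := by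
  have h1 := eLpNorm_add_le hb.1 (ha.sub hb).1 (p := 2) (by norm_num)
  rw [add_sub_cancel, eLpNorm_two_eq_ofReal_sqrt ha, eLpNorm_two_eq_ofReal_sqrt hb,
    eLpNorm_two_eq_ofReal_sqrt (ha.sub hb), ← ENNReal.ofReal_add (Real.sqrt_nonneg _)
    (Real.sqrt_nonneg _), ENNReal.ofReal_le_ofReal_iff (by positivity)] at h1
  exact h1

theorem tendsto_sqrt_integral_norm {f : ℕ → α → ℂ} {g : α → ℂ} (hf : ∀ n, MemLp (f n) 2 μ)
    (hg : MemLp g 2 μ) (h : Tendsto (fun n => eLpNorm (fun x => f n x - g x) 2 μ) atTop (𝓝 0)) :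
    Tendsto (fun n => √(∫ x, ‖f n x‖ ^ 2 ∂μ)) atTop (𝓝 √(∫ x, ‖g x‖ ^ 2 ∂μ)) := by
  rw [tendsto_iff_norm_sub_tendsto_zero]
  refine squeeze_zero (fun _ => norm_nonneg _) (fun n => ?_) (tendsto_sqrt_integral_norm_sq hf hg h)
  rw [Real.norm_eq_abs, abs_le]
  have h1 := sqrt_integral_norm_sq_le_add (hf n) hg
  have h2 := sqrt_integral_norm_sq_le_add hg (hf n)
  simp only [norm_sub_rev (g _)] at h2
  constructor <;> linarith

theorem tendsto_integral_mul {f : ℕ → α → ℂ} {g w : α → ℂ} (hf : ∀ n, MemLp (f n) 2 μ)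
    (hg : MemLp g 2 μ) (hw : MemLp w 2 μ)
    (h : Tendsto (fun n => eLpNorm (fun x => f n x - g x) 2 μ) atTop (𝓝 0)) :
    Tendsto (fun n => ∫ x, f n x * w x ∂μ) atTop (𝓝 (∫ x, g x * w x ∂μ)) := by
  rw [tendsto_iff_norm_sub_tendsto_zero]
  have h1 := (tendsto_sqrt_integral_norm_sq hf hg h).mul_const √(∫ x, ‖w x‖ ^ 2 ∂μ)
  rw [zero_mul] at h1
  refine squeeze_zero (fun _ => norm_nonneg _) (fun n => ?_) h1
  rw [← integral_sub ((hf n).integrable_mul_two hw) (hg.integrable_mul_two hw)]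
  simp only [← sub_mul]
  exact norm_integral_mul_le ((hf n).sub hg) hw

theorem MeasureTheory.MemLp.conj {f : α → ℂ} (hf : MemLp f 2 μ) :
    MemLp (fun x => conj (f x)) 2 μ := by
  refine hf.of_le (Complex.continuous_conj.comp_aestronglyMeasurable hf.1) ?_
  simp

end L2

/-! ### The measures on the square and on its sides. -/

theorem squareMeasure_eq_prod : squareMeasure = sideMeasure.prod sideMeasure := by
  rw [squareMeasure, sideMeasure, Measure.prod_restrict]
  rfl

instance : IsProbabilityMeasure sideMeasure :=
  ⟨by simp [sideMeasure]⟩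

instance : IsProbabilityMeasure squareMeasure := by
  rw [squareMeasure_eq_prod]; infer_instance

theorem integral_sideMeasure {E : Type*} [NormedAddCommGroup E] [NormedSpace ℝ E] (f : ℝ → E) :
    ∫ y, f y ∂sideMeasure = ∫ y in (0 : ℝ)..1, f y := by
  rw [intervalIntegral.integral_of_le zero_le_one, integral_Ioc_eq_integral_Ioo, sideMeasure]

theorem ae_mem_sideMeasure : ∀ᵐ y ∂sideMeasure, y ∈ Ioo (0 : ℝ) 1 :=
  ae_restrict_mem measurableSet_Ioo

theorem ae_mem_squareMeasure : ∀ᵐ z ∂squareMeasure, z ∈ unitSquare :=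
  ae_restrict_mem (measurableSet_Ioo.prod measurableSet_Ioo)

theorem Continuous.memLp_sideMeasure {E : Type*} [NormedAddCommGroup E] {f : ℝ → E}
    (hf : Continuous f) {p : ENNReal} : MemLp f p sideMeasure := by
  obtain ⟨C, hC⟩ := (isCompact_Icc (a := (0 : ℝ)) (b := 1)).exists_bound_of_continuousOn
    hf.continuousOn
  exact MemLp.of_bound hf.aestronglyMeasurable C
    (ae_mem_sideMeasure.mono fun y hy => hC y (Ioo_subset_Icc_self hy))

theorem Continuous.memLp_squareMeasure {E : Type*} [NormedAddCommGroup E] {f : ℝ × ℝ → E}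
    (hf : Continuous f) {p : ENNReal} : MemLp f p squareMeasure := by
  obtain ⟨C, hC⟩ := ((isCompact_Icc (a := (0 : ℝ)) (b := 1)).prod
    (isCompact_Icc (a := (0 : ℝ)) (b := 1))).exists_bound_of_continuousOn hf.continuousOn
  refine MemLp.of_bound hf.aestronglyMeasurable C (ae_mem_squareMeasure.mono fun y hy => hC y ?_)
  exact ⟨Ioo_subset_Icc_self hy.1, Ioo_subset_Icc_self hy.2⟩

theorem Continuous.integrable_sideMeasure {E : Type*} [NormedAddCommGroup E] {f : ℝ → E}
    (hf : Continuous f) : Integrable f sideMeasure :=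
  memLp_one_iff_integrable.1 hf.memLp_sideMeasure

theorem Continuous.integrable_squareMeasure {E : Type*} [NormedAddCommGroup E] {f : ℝ × ℝ → E}
    (hf : Continuous f) : Integrable f squareMeasure :=
  memLp_one_iff_integrable.1 hf.memLp_squareMeasure

theorem integral_squareMeasure {E : Type*} [NormedAddCommGroup E] [NormedSpace ℝ E]
    {f : ℝ × ℝ → E} (hf : Continuous f) :
    ∫ z, f z ∂squareMeasure = ∫ x, ∫ y, f (x, y) ∂sideMeasure ∂sideMeasure := by
  have := hf.integrable_squareMeasure
  rw [squareMeasure_eq_prod] at this ⊢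
  exact integral_prod _ this

theorem integral_squareMeasure_symm {E : Type*} [NormedAddCommGroup E] [NormedSpace ℝ E]
    {f : ℝ × ℝ → E} (hf : Continuous f) :
    ∫ z, f z ∂squareMeasure = ∫ y, ∫ x, f (x, y) ∂sideMeasure ∂sideMeasure := by
  have := hf.integrable_squareMeasure
  rw [squareMeasure_eq_prod] at this ⊢
  exact integral_prod_symm _ this

/-! ### Integration by parts on the square -/

theorem ContDiff.continuous_fderiv_dir {F : ℝ × ℝ → ℂ} (hF : ContDiff ℝ ∞ F) (e : ℝ × ℝ) :
    Continuous fun z => fderiv ℝ F z e :=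
  (hF.continuous_fderiv (by simp)).clm_apply continuous_const

theorem integral_fderiv_fst {F : ℝ × ℝ → ℂ} (hF : ContDiff ℝ ∞ F) :
    ∫ z, fderiv ℝ F z (1, 0) ∂squareMeasure
      = ∫ y, F (1, y) ∂sideMeasure - ∫ y, F (0, y) ∂sideMeasure := by
  have hc := hF.continuous
  rw [integral_squareMeasure_symm (hF.continuous_fderiv_dir _), ← integral_sub
    (Continuous.integrable_sideMeasure (by fun_prop))
    (Continuous.integrable_sideMeasure (by fun_prop))]
  congr 1 with y
  rw [integral_sideMeasure]
  refine intervalIntegral.integral_eq_sub_of_hasDerivAt (f := fun x => F (x, y)) (fun x _ => ?_)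
    (((hF.continuous_fderiv_dir _).comp (by fun_prop : Continuous fun x : ℝ => (x, y))
      ).intervalIntegrable _ _)
  have h1 : HasFDerivAt F (fderiv ℝ F (x, y)) (x, y) :=
    (hF.differentiable (by simp) _).hasFDerivAt
  exact h1.comp_hasDerivAt x ((hasDerivAt_id x).prodMk (hasDerivAt_const x y))

theorem integral_fderiv_snd {F : ℝ × ℝ → ℂ} (hF : ContDiff ℝ ∞ F) :
    ∫ z, fderiv ℝ F z (0, 1) ∂squareMeasure
      = ∫ x, F (x, 1) ∂sideMeasure - ∫ x, F (x, 0) ∂sideMeasure := by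
  have hc := hF.continuous
  rw [integral_squareMeasure (hF.continuous_fderiv_dir _), ← integral_sub
    (Continuous.integrable_sideMeasure (by fun_prop))
    (Continuous.integrable_sideMeasure (by fun_prop))]
  congr 1 with x
  rw [integral_sideMeasure]
  refine intervalIntegral.integral_eq_sub_of_hasDerivAt (f := fun y => F (x, y)) (fun y _ => ?_)
    (((hF.continuous_fderiv_dir _).comp (by fun_prop : Continuous fun y : ℝ => (x, y))
      ).intervalIntegrable _ _)
  have h1 : HasFDerivAt F (fderiv ℝ F (x, y)) (x, y) :=
    (hF.differentiable (by simp) _).hasFDerivAt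
  exact h1.comp_hasDerivAt y ((hasDerivAt_const y x).prodMk (hasDerivAt_id y))

theorem fderiv_mul_dir {F G : ℝ × ℝ → ℂ} (hF : ContDiff ℝ ∞ F) (hG : ContDiff ℝ ∞ G)
    (z e : ℝ × ℝ) :
    fderiv ℝ (fun z => F z * G z) z e = G z * fderiv ℝ F z e + fderiv ℝ G z e * F z := by
  rw [fderiv_fun_mul (hF.differentiable (by simp) _) (hG.differentiable (by simp) _)]
  simp; ring

theorem Side.continuous_point (s : Side) : Continuous s.point := by
  cases s <;> unfold Side.point <;> fun_prop

/-- Passage to the limit in an integration by parts formula for smooth functions. -/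
theorem integral_by_parts_of_approx {v ve : ℝ × ℝ → ℂ} {τ : ℝ → ℂ} {s : Side} {e : ℝ × ℝ}
    (hv : MemLp v 2 squareMeasure) (hve : MemLp ve 2 squareMeasure) (hτ : MemLp τ 2 sideMeasure)
    {φ : ℕ → ℝ × ℝ → ℂ} (hφ : ∀ n, ContDiff ℝ ∞ (φ n))
    (h0 : Tendsto (fun n => eLpNorm (fun z => φ n z - v z) 2 squareMeasure) atTop (𝓝 0))
    (he : Tendsto (fun n => eLpNorm (fun z => fderiv ℝ (φ n) z e - ve z) 2 squareMeasure)
      atTop (𝓝 0))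
    (ht : Tendsto (fun n => eLpNorm (fun y => φ n (s.point y) - τ y) 2 sideMeasure) atTop (𝓝 0))
    {F : ℝ × ℝ → ℂ} (hF : ContDiff ℝ ∞ F) (σ : ℂ)
    (hparts : ∀ ψ : ℝ × ℝ → ℂ, ContDiff ℝ ∞ ψ →
      ∫ z, fderiv ℝ (fun z => F z * ψ z) z e ∂squareMeasure
        = σ * ∫ y, F (s.point y) * ψ (s.point y) ∂sideMeasure) :
    ∫ z, v z * fderiv ℝ F z e ∂squareMeasure + ∫ z, ve z * F z ∂squareMeasure
      = σ * ∫ y, τ y * F (s.point y) ∂sideMeasure := by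
  have hF' := hF.continuous_fderiv_dir e
  have hm : ∀ n, MemLp (φ n) 2 squareMeasure := fun n => (hφ n).continuous.memLp_squareMeasure
  have hme : ∀ n, MemLp (fun z => fderiv ℝ (φ n) z e) 2 squareMeasure := fun n =>
    ((hφ n).continuous_fderiv_dir e).memLp_squareMeasure
  have hms : ∀ n, MemLp (fun y => φ n (s.point y)) 2 sideMeasure := fun n =>
    ((hφ n).continuous.comp s.continuous_point).memLp_sideMeasure
  have L1 := tendsto_integral_mul hm hv hF'.memLp_squareMeasure h0
  have L2 := tendsto_integral_mul hme hve hF.continuous.memLp_squareMeasure he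
  have L3 := (tendsto_integral_mul hms hτ
    (hF.continuous.comp s.continuous_point).memLp_sideMeasure ht).const_mul σ
  refine tendsto_nhds_unique (L1.add L2) (L3.congr fun n => ?_)
  rw [← integral_add ((hm n).integrable_mul_two hF'.memLp_squareMeasure)
    ((hme n).integrable_mul_two hF.continuous.memLp_squareMeasure)]
  simp only [← fderiv_mul_dir hF (hφ n)]
  rw [hparts _ (hφ n)]
  simp [mul_comm]

/-- `HasTrace` provides a separate approximating sequence for each side, so the two boundary terms
cannot come from one limit. Splitting `F = xF + (1 - x)F` gives two test functions, each vanishing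
on one of the vertical sides, and each needs only one of the two sequences. -/
theorem integral_by_parts_fst {v vx vy : ℝ × ℝ → ℂ} (hv : MemH1 v vx vy) {τ : Side → ℝ → ℂ}
    (hτ : ∀ s, HasTrace v vx vy s (τ s)) {F : ℝ × ℝ → ℂ} (hF : ContDiff ℝ ∞ F) :
    ∫ z, v z * fderiv ℝ F z (1, 0) ∂squareMeasure + ∫ z, vx z * F z ∂squareMeasure
      = ∫ y, τ .right y * F (1, y) ∂sideMeasure - ∫ y, τ .left y * F (0, y) ∂sideMeasure := by
  obtain ⟨hr, φ, h1, h2, h3, -, h5⟩ := hτ .right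
  obtain ⟨hl, ψ, k1, k2, k3, -, k5⟩ := hτ .left
  have hX : ContDiff ℝ ∞ (fun z : ℝ × ℝ => (z.1 : ℂ)) :=
    Complex.ofRealCLM.contDiff.comp contDiff_fst
  have hA : ContDiff ℝ ∞ (fun z : ℝ × ℝ => (z.1 : ℂ) * F z) := hX.mul hF
  have hB : ContDiff ℝ ∞ (fun z : ℝ × ℝ => (1 - (z.1 : ℂ)) * F z) :=
    (contDiff_const.sub hX).mul hF
  have R := integral_by_parts_of_approx hv.1 hv.2 hr h1 h2 h3 h5 hA 1 (fun ζ hζ => by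
    rw [integral_fderiv_fst (hA.mul hζ)]; simp [Side.point])
  have S := integral_by_parts_of_approx hv.1 hv.2 hl k1 k2 k3 k5 hB (-1) (fun ζ hζ => by
    rw [integral_fderiv_fst (hB.mul hζ)]; simp [Side.point])
  simp only [Side.point, Complex.ofReal_one, Complex.ofReal_zero, one_mul, sub_zero] at R S
  have e0 : ∀ z, F z = (z.1 : ℂ) * F z + (1 - (z.1 : ℂ)) * F z := fun z => by ring
  have e1 : ∀ z, fderiv ℝ F z (1, 0) = fderiv ℝ (fun z : ℝ × ℝ => (z.1 : ℂ) * F z) z (1, 0)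
      + fderiv ℝ (fun z : ℝ × ℝ => (1 - (z.1 : ℂ)) * F z) z (1, 0) := fun z => by
    conv_lhs => rw [show F = fun z => (z.1 : ℂ) * F z + (1 - (z.1 : ℂ)) * F z from funext e0]
    rw [fderiv_fun_add (hA.differentiable (by simp) _) (hB.differentiable (by simp) _)]
    rfl
  have i1 : ∫ z, v z * fderiv ℝ F z (1, 0) ∂squareMeasure
      = ∫ z, v z * fderiv ℝ (fun z : ℝ × ℝ => (z.1 : ℂ) * F z) z (1, 0) ∂squareMeasure
      + ∫ z, v z * fderiv ℝ (fun z : ℝ × ℝ => (1 - (z.1 : ℂ)) * F z) z (1, 0) ∂squareMeasure := by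
    simp only [e1, mul_add]
    exact integral_add (hv.1.integrable_mul_two (hA.continuous_fderiv_dir _).memLp_squareMeasure)
      (hv.1.integrable_mul_two (hB.continuous_fderiv_dir _).memLp_squareMeasure)
  have i2 : ∫ z, vx z * F z ∂squareMeasure = ∫ z, vx z * ((z.1 : ℂ) * F z) ∂squareMeasure
      + ∫ z, vx z * ((1 - (z.1 : ℂ)) * F z) ∂squareMeasure := by
    rw [← integral_add (hv.2.integrable_mul_two hA.continuous.memLp_squareMeasure)
      (hv.2.integrable_mul_two hB.continuous.memLp_squareMeasure)]
    congr 1 with z; ring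
  rw [i1, i2]
  linear_combination R + S

theorem integral_by_parts_snd {v vx vy : ℝ × ℝ → ℂ} (hv : MemH1 v vx vy) {τ : Side → ℝ → ℂ}
    (hτ : ∀ s, HasTrace v vx vy s (τ s)) {F : ℝ × ℝ → ℂ} (hF : ContDiff ℝ ∞ F) :
    ∫ z, v z * fderiv ℝ F z (0, 1) ∂squareMeasure + ∫ z, vy z * F z ∂squareMeasure
      = ∫ x, τ .top x * F (x, 1) ∂sideMeasure - ∫ x, τ .bottom x * F (x, 0) ∂sideMeasure := by
  obtain ⟨hr, φ, h1, h2, -, h3, h5⟩ := hτ .top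
  obtain ⟨hl, ψ, k1, k2, -, k3, k5⟩ := hτ .bottom
  have hX : ContDiff ℝ ∞ (fun z : ℝ × ℝ => (z.2 : ℂ)) :=
    Complex.ofRealCLM.contDiff.comp contDiff_snd
  have hA : ContDiff ℝ ∞ (fun z : ℝ × ℝ => (z.2 : ℂ) * F z) := hX.mul hF
  have hB : ContDiff ℝ ∞ (fun z : ℝ × ℝ => (1 - (z.2 : ℂ)) * F z) :=
    (contDiff_const.sub hX).mul hF
  have R := integral_by_parts_of_approx hv.1 hv.3 hr h1 h2 h3 h5 hA 1 (fun ζ hζ => by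
    rw [integral_fderiv_snd (hA.mul hζ)]; simp [Side.point])
  have S := integral_by_parts_of_approx hv.1 hv.3 hl k1 k2 k3 k5 hB (-1) (fun ζ hζ => by
    rw [integral_fderiv_snd (hB.mul hζ)]; simp [Side.point])
  simp only [Side.point, Complex.ofReal_one, Complex.ofReal_zero, one_mul, sub_zero] at R S
  have e0 : ∀ z, F z = (z.2 : ℂ) * F z + (1 - (z.2 : ℂ)) * F z := fun z => by ring
  have e1 : ∀ z, fderiv ℝ F z (0, 1) = fderiv ℝ (fun z : ℝ × ℝ => (z.2 : ℂ) * F z) z (0, 1)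
      + fderiv ℝ (fun z : ℝ × ℝ => (1 - (z.2 : ℂ)) * F z) z (0, 1) := fun z => by
    conv_lhs => rw [show F = fun z => (z.2 : ℂ) * F z + (1 - (z.2 : ℂ)) * F z from funext e0]
    rw [fderiv_fun_add (hA.differentiable (by simp) _) (hB.differentiable (by simp) _)]
    rfl
  have i1 : ∫ z, v z * fderiv ℝ F z (0, 1) ∂squareMeasure
      = ∫ z, v z * fderiv ℝ (fun z : ℝ × ℝ => (z.2 : ℂ) * F z) z (0, 1) ∂squareMeasure
      + ∫ z, v z * fderiv ℝ (fun z : ℝ × ℝ => (1 - (z.2 : ℂ)) * F z) z (0, 1) ∂squareMeasure := by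
    simp only [e1, mul_add]
    exact integral_add (hv.1.integrable_mul_two (hA.continuous_fderiv_dir _).memLp_squareMeasure)
      (hv.1.integrable_mul_two (hB.continuous_fderiv_dir _).memLp_squareMeasure)
  have i2 : ∫ z, vy z * F z ∂squareMeasure = ∫ z, vy z * ((z.2 : ℂ) * F z) ∂squareMeasure
      + ∫ z, vy z * ((1 - (z.2 : ℂ)) * F z) ∂squareMeasure := by
    rw [← integral_add (hv.3.integrable_mul_two hA.continuous.memLp_squareMeasure)
      (hv.3.integrable_mul_two hB.continuous.memLp_squareMeasure)]
    congr 1 with z; ring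
  rw [i1, i2]
  linear_combination R + S

/-! ### The separated ordinary differential equation -/

theorem eq_of_hasDerivAt_zero {f : ℝ → ℝ} (h : ∀ x, HasDerivAt f 0 x) (x y : ℝ) : f x = f y :=
  is_const_of_deriv_eq_zero (fun x => (h x).differentiableAt) (fun x => (h x).deriv) x y

/-- Stability for propagating modes `v'' = (l - k²) v`, `l ≤ k²`, in terms of the real
and imaginary parts `p`, `q` of `v`. -/
theorem integral_energy_le_of_propagating {k l : ℝ} (hk : 0 < k) (hc : l ≤ k ^ 2) (hl : l = 0 ∨ 2 ≤ l)
    {p p' q q' : ℝ → ℝ}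
    (hp : ∀ x, HasDerivAt p (p' x) x) (hp' : ∀ x, HasDerivAt p' ((l - k ^ 2) * p x) x)
    (hq : ∀ x, HasDerivAt q (q' x) x) (hq' : ∀ x, HasDerivAt q' ((l - k ^ 2) * q x) x)
    (him : 0 ≤ q' 1 * p 1 - p' 1 * q 1) {G : ℝ}
    (hG0 : 0 ≤ G) (hG : G ^ 2 = (p' 0 - k * q 0) ^ 2 + (q' 0 + k * p 0) ^ 2) :
    ∫ x in (0 : ℝ)..1, (p' x ^ 2 + q' x ^ 2 + (l + k ^ 2) * (p x ^ 2 + q x ^ 2))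
      ≤ 6 * max k 1 ^ 2 * G ^ 2 := by
  have cp : Continuous p := continuous_iff_continuousAt.2 fun x => (hp x).continuousAt
  have cq : Continuous q := continuous_iff_continuousAt.2 fun x => (hq x).continuousAt
  have cp' : Continuous p' := continuous_iff_continuousAt.2 fun x => (hp' x).continuousAt
  have cq' : Continuous q' := continuous_iff_continuousAt.2 fun x => (hq' x).continuousAt
  have hl0 : 0 ≤ l := by rcases hl with h | h <;> linarith
  have hW : q' 0 * p 0 - p' 0 * q 0 = q' 1 * p 1 - p' 1 * q 1 :=
    eq_of_hasDerivAt_zero (f := fun x => q' x * p x - p' x * q x) (fun x =>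
      ((((hq' x).mul (hp x)).sub ((hp' x).mul (hq x))).congr_deriv (by ring))) 0 1
  -- `G²` is the left side plus `2k` times the flux at `0`, and the flux, being constant, equals its
  -- nonnegative value at `1`.
  have h0 : p' 0 ^ 2 + q' 0 ^ 2 + k ^ 2 * (p 0 ^ 2 + q 0 ^ 2) ≤ G ^ 2 := by
    have : 0 ≤ k * (q' 0 * p 0 - p' 0 * q 0) := mul_nonneg hk.le (by rw [hW]; exact him)
    nlinarith
  -- Conservation of energy for the oscillator `v'' = -(k² - l) v`.
  have hE : ∀ x, p' x ^ 2 + q' x ^ 2 - (l - k ^ 2) * (p x ^ 2 + q x ^ 2)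
      = p' 0 ^ 2 + q' 0 ^ 2 - (l - k ^ 2) * (p 0 ^ 2 + q 0 ^ 2) := fun x =>
    eq_of_hasDerivAt_zero (f := fun x => p' x ^ 2 + q' x ^ 2 - (l - k ^ 2) * (p x ^ 2 + q x ^ 2))
      (fun x => (((hp' x).pow 2).add ((hq' x).pow 2)).sub
        ((((hp x).pow 2).add ((hq x).pow 2)).const_mul (l - k ^ 2)) |>.congr_deriv
          (by push_cast; ring)) x 0
  have hM1 : 1 ≤ max k 1 := le_max_right _ _
  have hMk : k ≤ max k 1 := le_max_left _ _
  set M := max k 1 with hM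
  have hM2 : 1 ≤ M ^ 2 := one_le_pow₀ hM1
  have hG2 : 0 ≤ G ^ 2 := sq_nonneg G
  have hE' : ∀ x, p' x ^ 2 + q' x ^ 2 + (k ^ 2 - l) * (p x ^ 2 + q x ^ 2) ≤ G ^ 2 := by
    intro x
    have h1 := hE x
    have h2 : 0 ≤ l * (p 0 ^ 2 + q 0 ^ 2) := by positivity
    nlinarith
  -- Conservation gives `|v'| ≤ G`, so `|v(x)| ≤ |v(0)| + Gx` by the mean value inequality, while
  -- `k|v(0)| ≤ G`. This avoids dividing by `k² - l`, which may be arbitrarily small.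
  have hN : ∀ x ∈ Icc (0 : ℝ) 1, k ^ 2 * (p x ^ 2 + q x ^ 2) ≤ G ^ 2 * (1 + k * x) ^ 2 := by
    intro x hx
    let f : ℝ → ℂ := fun x => (p x : ℂ) + q x * Complex.I
    have hnorm : ∀ a b : ℝ, ‖(a : ℂ) + b * Complex.I‖ = √(a ^ 2 + b ^ 2) := fun a b =>
      Complex.norm_add_mul_I a b
    have hf : ∀ x, HasDerivAt f ((p' x : ℂ) + q' x * Complex.I) x := fun x =>
      ((hp x).ofReal_comp).add (((hq x).ofReal_comp).mul_const _)
    have hb := norm_image_sub_le_of_norm_deriv_le_segment' (f := f) (a := 0) (b := 1) (C := G)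
      (fun x _ => (hf x).hasDerivWithinAt) (fun x _ => by
        rw [hnorm]
        refine Real.sqrt_le_iff.2 ⟨hG0, ?_⟩
        have h1 := hE' x
        have h2 : 0 ≤ (k ^ 2 - l) * (p x ^ 2 + q x ^ 2) :=
          mul_nonneg (by linarith) (by positivity)
        linarith) x hx
    have h3 : ‖f x‖ ≤ ‖f 0‖ + G * x := by
      have := norm_sub_norm_le (f x) (f 0)
      simp only [sub_zero] at hb
      linarith
    have h4 : k * ‖f 0‖ ≤ G := by
      refine abs_le_of_sq_le_sq' ?_ hG0 |>.2
      rw [mul_pow, hnorm, Real.sq_sqrt (by positivity)]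
      nlinarith [sq_nonneg (p' 0), sq_nonneg (q' 0)]
    have h5 : k * ‖f x‖ ≤ G * (1 + k * x) := by nlinarith
    have h6 : (k * ‖f x‖) ^ 2 ≤ (G * (1 + k * x)) ^ 2 := by gcongr
    rw [mul_pow, mul_pow, hnorm, Real.sq_sqrt (by positivity)] at h6
    exact h6
  calc ∫ x in (0 : ℝ)..1, (p' x ^ 2 + q' x ^ 2 + (l + k ^ 2) * (p x ^ 2 + q x ^ 2))
      ≤ ∫ x in (0 : ℝ)..1, (3 * G ^ 2 + 4 * k * G ^ 2 * x + 2 * k ^ 2 * G ^ 2 * x ^ 2) := by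
        -- The integrand is the conserved energy plus `2l|v|²`, hence at most `G² + 2G²(1 + kx)²`.
        refine intervalIntegral.integral_mono_on zero_le_one
          (Continuous.intervalIntegrable (by fun_prop) _ _)
          (Continuous.intervalIntegrable (by fun_prop) _ _) fun x hx => ?_
        have h1 := hE' x
        have h2 := hN x hx
        have h3 : l * (p x ^ 2 + q x ^ 2) ≤ k ^ 2 * (p x ^ 2 + q x ^ 2) := by gcongr
        nlinarith
    _ = (3 + 2 * k + 2 * k ^ 2 / 3) * G ^ 2 := by
        rw [intervalIntegral.integral_add, intervalIntegral.integral_add,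
          intervalIntegral.integral_const, intervalIntegral.integral_const_mul,
          intervalIntegral.integral_const_mul, integral_id, integral_pow]
        · simp; ring
        all_goals exact Continuous.intervalIntegrable (by fun_prop) _ _
    _ ≤ 6 * M ^ 2 * G ^ 2 := by
        refine mul_le_mul_of_nonneg_right ?_ hG2
        nlinarith
/-- Stability for evanescent modes `v'' = (l - k²) v`, `k² < l`, in terms of the real
and imaginary parts `p`, `q` of `v`. -/
theorem integral_energy_le_of_evanescent {k l : ℝ} (hk : 0 < k) (hc : k ^ 2 < l) (hl : l = 0 ∨ 2 ≤ l)
    {p p' q q' : ℝ → ℝ}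
    (hp : ∀ x, HasDerivAt p (p' x) x) (hp' : ∀ x, HasDerivAt p' ((l - k ^ 2) * p x) x)
    (hq : ∀ x, HasDerivAt q (q' x) x) (hq' : ∀ x, HasDerivAt q' ((l - k ^ 2) * q x) x)
    (hre : p' 1 * p 1 + q' 1 * q 1 = 0) (him : 0 ≤ q' 1 * p 1 - p' 1 * q 1) {G : ℝ}
    (hG : G ^ 2 = (p' 0 - k * q 0) ^ 2 + (q' 0 + k * p 0) ^ 2) :
    ∫ x in (0 : ℝ)..1, (p' x ^ 2 + q' x ^ 2 + (l + k ^ 2) * (p x ^ 2 + q x ^ 2))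
      ≤ 6 * max k 1 ^ 2 * G ^ 2 := by
  have cp : Continuous p := continuous_iff_continuousAt.2 fun x => (hp x).continuousAt
  have cq : Continuous q := continuous_iff_continuousAt.2 fun x => (hq x).continuousAt
  have cp' : Continuous p' := continuous_iff_continuousAt.2 fun x => (hp' x).continuousAt
  have cq' : Continuous q' := continuous_iff_continuousAt.2 fun x => (hq' x).continuousAt
  have hW : q' 0 * p 0 - p' 0 * q 0 = q' 1 * p 1 - p' 1 * q 1 :=
    eq_of_hasDerivAt_zero (f := fun x => q' x * p x - p' x * q x) (fun x =>
      ((((hq' x).mul (hp x)).sub ((hp' x).mul (hq x))).congr_deriv (by ring))) 0 1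
  have h0 : p' 0 ^ 2 + q' 0 ^ 2 + k ^ 2 * (p 0 ^ 2 + q 0 ^ 2) ≤ G ^ 2 := by
    have : 0 ≤ k * (q' 0 * p 0 - p' 0 * q 0) := mul_nonneg hk.le (by rw [hW]; exact him)
    nlinarith
  have hM1 : 1 ≤ max k 1 := le_max_right _ _
  set M := max k 1 with hM
  have hM2 : 1 ≤ M ^ 2 := one_le_pow₀ hM1
  have hG2 : 0 ≤ G ^ 2 := sq_nonneg G
  set c := l - k ^ 2 with hcdef
  have hc0 : 0 < c := by rw [hcdef]; linarith
  let R : ℝ → ℝ := fun x => p' x * p x + q' x * q x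
  let e : ℝ → ℝ := fun x => p' x ^ 2 + q' x ^ 2 + c * (p x ^ 2 + q x ^ 2)
  let N : ℝ → ℝ := fun x => p x ^ 2 + q x ^ 2
  have cR : Continuous R := by fun_prop
  have ce : Continuous e := by fun_prop
  have cN : Continuous N := by fun_prop
  have he0 : ∀ x, 0 ≤ e x := fun x => by positivity
  -- `R = Re(v̄ v')` is half the derivative of `N = |v|²`, and its own derivative is the nonnegative
  -- energy density. As `R(1) = 0`, both `R ≤ 0` and the decrease of `N` follow on `[0,1]`.
  have hR : ∀ x, HasDerivAt R (e x) x := fun x =>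
    (((hp' x).mul (hp x)).add ((hq' x).mul (hq x))).congr_deriv (by simp only [e]; ring)
  have hNd : ∀ x, HasDerivAt N (2 * R x) x := fun x =>
    (((hp x).pow 2).add ((hq x).pow 2)).congr_deriv (by simp only [R]; push_cast; ring)
  have hRmono : Monotone R := monotone_of_hasDerivAt_nonneg hR he0
  have hRneg : ∀ x ≤ 1, R x ≤ 0 := fun x hx => (hRmono hx).trans hre.le
  have hNle : ∀ x ∈ Icc (0 : ℝ) 1, N x ≤ N 0 := by
    intro x hx
    have := antitoneOn_of_deriv_nonpos (convex_Icc (0 : ℝ) 1) (f := N) cN.continuousOn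
      (fun x _ => (hNd x).differentiableAt.differentiableWithinAt) (fun x hx => by
        rw [(hNd x).deriv]
        rw [interior_Icc] at hx
        linarith [hRneg x hx.2.le])
    exact this (left_mem_Icc.2 zero_le_one) hx hx.1
  set F := ∫ x in (0 : ℝ)..1, e x with hF
  have hFR : F = - R 0 := by
    rw [hF, intervalIntegral.integral_eq_sub_of_hasDerivAt (fun x _ => hR x)
      (ce.intervalIntegrable _ _)]
    rw [show R 1 = 0 from hre]; ring
  have hIN : ∫ x in (0 : ℝ)..1, N x ≤ N 0 := by
    have := intervalIntegral.integral_mono_on (μ := volume) zero_le_one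
      (cN.intervalIntegrable _ _) (continuous_const.intervalIntegrable _ _) hNle
    simpa using this
  have hsplit : ∫ x in (0 : ℝ)..1, (p' x ^ 2 + q' x ^ 2 + (l + k ^ 2) * (p x ^ 2 + q x ^ 2))
      = F + 2 * k ^ 2 * ∫ x in (0 : ℝ)..1, N x := by
    rw [hF, ← intervalIntegral.integral_const_mul, ← intervalIntegral.integral_add
      (ce.intervalIntegrable _ _) (Continuous.intervalIntegrable (by fun_prop) _ _)]
    congr 1 with x
    simp only [e, N, hcdef]; ring
  have hkN : k ^ 2 * N 0 ≤ G ^ 2 := by nlinarith [sq_nonneg (p' 0), sq_nonneg (q' 0)]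
  have hcs : R 0 ^ 2 ≤ (p' 0 ^ 2 + q' 0 ^ 2) * N 0 := by
    simp only [R, N]; nlinarith [sq_nonneg (p' 0 * q 0 - q' 0 * p 0)]
  have hd0 : p' 0 ^ 2 + q' 0 ^ 2 ≤ G ^ 2 := by
    have : 0 ≤ k ^ 2 * (p 0 ^ 2 + q 0 ^ 2) := by positivity
    linarith
  have hNn : ∀ x, 0 ≤ N x := fun x => by positivity
  -- Since `F = -R(0)`, Cauchy–Schwarz gives `F² ≤ |v'(0)|² N(0) ≤ G² N(0)`, so only `N(0)` has to
  -- be bounded. For `k ≥ 1` it is at most `G²`. For `k < 1` that bound is lost, but the spectral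
  -- gap gives `l - k² ≥ 1`, whence `N(0) ≤ 2F` and one factor `F` cancels.
  have hF2 : F ≤ 4 * G ^ 2 := by
    rcases le_or_gt 1 k with h1 | h1
    · have hN0 : N 0 ≤ G ^ 2 :=
        (le_mul_of_one_le_left (hNn 0) (one_le_pow₀ h1)).trans hkN
      have hRG : R 0 ^ 2 ≤ (G ^ 2) ^ 2 := by
        calc R 0 ^ 2 ≤ (p' 0 ^ 2 + q' 0 ^ 2) * N 0 := hcs
          _ ≤ G ^ 2 * G ^ 2 := mul_le_mul hd0 hN0 (hNn 0) hG2
          _ = (G ^ 2) ^ 2 := by ring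
      have := (abs_le_of_sq_le_sq' hRG hG2).1
      rw [hFR]
      linarith
    · have hl2 : 2 ≤ l := by
        rcases hl with h | h
        · have : 0 < k ^ 2 := by positivity
          linarith
        · exact h
      have hc1 : 1 ≤ c := by
        have : k ^ 2 ≤ 1 := pow_le_one₀ hk.le h1.le
        rw [hcdef]; linarith
      have hN0 : N 0 ≤ 2 * F := by
        -- The weight `x - 1` vanishes at `1` and equals `-1` at `0`, so integrating the derivative
        -- of `(x - 1) N` recovers `N(0)`.
        have hd : ∀ x, HasDerivAt (fun x => (x - 1) * N x) (N x + (x - 1) * (2 * R x)) x :=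
          fun x => (((hasDerivAt_id x).sub_const 1).mul (hNd x)).congr_deriv (by simp)
        have hi := intervalIntegral.integral_eq_sub_of_hasDerivAt (a := 0) (b := 1)
          (fun x _ => hd x) (Continuous.intervalIntegrable (by fun_prop) _ _)
        have hi2 : N 0 = ∫ x in (0 : ℝ)..1, (N x + (x - 1) * (2 * R x)) := by rw [hi]; simp
        rw [hi2, hF, ← intervalIntegral.integral_const_mul]
        refine intervalIntegral.integral_mono_on zero_le_one
          (Continuous.intervalIntegrable (by fun_prop) _ _)
          (Continuous.intervalIntegrable (by fun_prop) _ _) fun x hx => ?_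
        have hN' : 0 ≤ N x := hNn x
        have hRx : -(2 * R x) ≤ p' x ^ 2 + q' x ^ 2 + N x := by
          simp only [R, N]; nlinarith [sq_nonneg (p' x + p x), sq_nonneg (q' x + q x)]
        have hex : p' x ^ 2 + q' x ^ 2 + N x ≤ e x := by
          have : N x ≤ c * N x := le_mul_of_one_le_left hN' hc1
          simp only [e, N] at this ⊢; linarith
        have hR0 := hRneg x hx.2
        have : (x - 1) * (2 * R x) ≤ -(2 * R x) := by
          have := mul_nonneg hx.1 (neg_nonneg.2 hR0)
          linarith
        linarith [sq_nonneg (p' x), sq_nonneg (q' x)]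
      have hF0 : 0 ≤ F := by
        rw [hFR]; linarith [hRneg 0 zero_le_one]
      have hFsq : F * F ≤ (2 * G ^ 2) * F := by
        calc F * F = R 0 ^ 2 := by rw [hFR]; ring
          _ ≤ (p' 0 ^ 2 + q' 0 ^ 2) * N 0 := hcs
          _ ≤ G ^ 2 * (2 * F) := mul_le_mul hd0 hN0 (hNn 0) hG2
          _ = (2 * G ^ 2) * F := by ring
      rcases hF0.eq_or_lt with h | h
      · rw [← h]; positivity
      · linarith [le_of_mul_le_mul_right hFsq h]
  rw [hsplit]
  have h1 : k ^ 2 * ∫ x in (0 : ℝ)..1, N x ≤ k ^ 2 * N 0 := by gcongr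
  have h2 : G ^ 2 ≤ M ^ 2 * G ^ 2 := le_mul_of_one_le_left hG2 hM2
  linarith

/-- Stability for `v'' = (l - k²) v` in terms of the real and imaginary parts `p`, `q` of `v`. -/
theorem integral_energy_le_aux {k l : ℝ} (hk : 0 < k) (hl : l = 0 ∨ 2 ≤ l)
    {p p' q q' : ℝ → ℝ}
    (hp : ∀ x, HasDerivAt p (p' x) x) (hp' : ∀ x, HasDerivAt p' ((l - k ^ 2) * p x) x)
    (hq : ∀ x, HasDerivAt q (q' x) x) (hq' : ∀ x, HasDerivAt q' ((l - k ^ 2) * q x) x)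
    (hre : p' 1 * p 1 + q' 1 * q 1 = 0) (him : 0 ≤ q' 1 * p 1 - p' 1 * q 1) {G : ℝ}
    (hG0 : 0 ≤ G) (hG : G ^ 2 = (p' 0 - k * q 0) ^ 2 + (q' 0 + k * p 0) ^ 2) :
    ∫ x in (0 : ℝ)..1, (p' x ^ 2 + q' x ^ 2 + (l + k ^ 2) * (p x ^ 2 + q x ^ 2))
      ≤ 6 * max k 1 ^ 2 * G ^ 2 := by
  rcases le_or_gt l (k ^ 2) with hc | hc
  · exact integral_energy_le_of_propagating hk hc hl hp hp' hq hq' him hG0 hG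
  · exact integral_energy_le_of_evanescent hk hc hl hp hp' hq hq' hre him hG

/-! ### Complex axial solutions and their boundary conditions. -/

/-- `v` is smooth with `v' = w` and `v'' = c v`. -/
structure IsModeSolution (c : ℝ) (v w : ℝ → ℂ) : Prop where
  contDiff : ContDiff ℝ ∞ v
  contDiff_deriv : ContDiff ℝ ∞ w
  hasDerivAt : ∀ x, HasDerivAt v (w x) x
  hasDerivAt_deriv : ∀ x, HasDerivAt w (c * v x) x

/-- The boundary condition at `x = 1` for a function with value `a` and derivative `b` there. -/
def BoundaryOperator.rightCondition (k : ℝ) (a b : ℂ) : BoundaryOperator → Prop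
  | .dirichlet => a = 0
  | .neumann => b = 0
  | .impedance => b = Complex.I * k * a

/-- All that the energy estimate needs from the condition at `x = 1`: `b ā` is `0` or `ik|a|²`, so
its real part vanishes and its imaginary part, the outgoing flux, is nonnegative. -/
theorem BoundaryOperator.rightCondition.re_im {k : ℝ} (hk : 0 < k) {a b : ℂ}
    {β : BoundaryOperator} (h : β.rightCondition k a b) :
    b.re * a.re + b.im * a.im = 0 ∧ 0 ≤ b.im * a.re - b.re * a.im := by
  cases β
  · simp only [rightCondition] at h; simp [h]
  · simp only [rightCondition] at h; simp [h]
  · simp only [rightCondition] at h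
    simp only [h, Complex.mul_re, Complex.mul_im, Complex.I_re, Complex.I_im, Complex.ofReal_re,
      Complex.ofReal_im]
    constructor
    · ring
    · have : 0 ≤ k * (a.re ^ 2 + a.im ^ 2) := by positivity
      linarith

theorem BoundaryOperator.rightCondition.add_mul {k : ℝ} {a b a' b' : ℂ} {β : BoundaryOperator}
    (h : β.rightCondition k a b) (h' : β.rightCondition k a' b') (A : ℂ) :
    β.rightCondition k (a + A * a') (b + A * b') := by
  cases β <;> simp only [rightCondition] at * <;> rw [h, h'] <;> ring

theorem HasDerivAt.complex_re {f : ℝ → ℂ} {f' : ℂ} {x : ℝ} (h : HasDerivAt f f' x) :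
    HasDerivAt (fun x => (f x).re) f'.re x :=
  (Complex.reCLM.hasFDerivAt (x := f x)).comp_hasDerivAt x h

theorem HasDerivAt.complex_im {f : ℝ → ℂ} {f' : ℂ} {x : ℝ} (h : HasDerivAt f f' x) :
    HasDerivAt (fun x => (f x).im) f'.im x :=
  (Complex.imCLM.hasFDerivAt (x := f x)).comp_hasDerivAt x h

theorem Complex.norm_sq_eq_re_im (z : ℂ) : ‖z‖ ^ 2 = z.re ^ 2 + z.im ^ 2 := by
  rw [Complex.sq_norm, Complex.normSq_apply]; ring

theorem IsModeSolution.integral_energy_le {k l : ℝ} (hk : 0 < k) (hl : l = 0 ∨ 2 ≤ l)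
    {v w : ℝ → ℂ} (h : IsModeSolution (l - k ^ 2) v w) {β : BoundaryOperator}
    (hβ : β.rightCondition k (v 1) (w 1)) :
    ∫ x, (‖w x‖ ^ 2 + (l + k ^ 2) * ‖v x‖ ^ 2) ∂sideMeasure
      ≤ 6 * max k 1 ^ 2 * ‖-w 0 - Complex.I * k * v 0‖ ^ 2 := by
  obtain ⟨h1, h2⟩ := hβ.re_im hk
  rw [integral_sideMeasure]
  simp only [Complex.norm_sq_eq_re_im (w _), Complex.norm_sq_eq_re_im (v _)]
  refine integral_energy_le_aux hk hl (fun x => (h.3 x).complex_re)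
    (fun x => (h.4 x).complex_re.congr_deriv (by simp [-Complex.ofReal_sub, -Complex.ofReal_pow]))
    (fun x => (h.3 x).complex_im)
    (fun x => (h.4 x).complex_im.congr_deriv (by simp [-Complex.ofReal_sub, -Complex.ofReal_pow]))
    h1 h2 (norm_nonneg _) ?_
  rw [Complex.norm_sq_eq_re_im]
  simp
  ring

/-- The flux argument again. Here it serves to show that vanishing impedance data at `0` forces
vanishing Cauchy data there. -/
theorem IsModeSolution.norm_sq_add_le {k l : ℝ} (hk : 0 < k)
    {v w : ℝ → ℂ} (h : IsModeSolution (l - k ^ 2) v w) {β : BoundaryOperator}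
    (hβ : β.rightCondition k (v 1) (w 1)) :
    ‖w 0‖ ^ 2 + k ^ 2 * ‖v 0‖ ^ 2 ≤ ‖-w 0 - Complex.I * k * v 0‖ ^ 2 := by
  obtain ⟨h1, h2⟩ := hβ.re_im hk
  have hW : (w 0).im * (v 0).re - (w 0).re * (v 0).im = (w 1).im * (v 1).re - (w 1).re * (v 1).im :=
    eq_of_hasDerivAt_zero (f := fun x => (w x).im * (v x).re - (w x).re * (v x).im) (fun x =>
      (((((h.4 x).complex_im).mul ((h.3 x).complex_re)).sub
        (((h.4 x).complex_re).mul ((h.3 x).complex_im))).congr_deriv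
        (by simp [-Complex.ofReal_sub, -Complex.ofReal_pow]; ring))) 0 1
  have : 0 ≤ k * ((w 0).im * (v 0).re - (w 0).re * (v 0).im) :=
    mul_nonneg hk.le (by rw [hW]; exact h2)
  simp only [Complex.norm_sq_eq_re_im]
  simp
  nlinarith

/-- With a complex square root `r` of `c`, both signs of `c` are covered by the same `cosh` and
`sinh` formula; only `r = 0` needs an affine solution. -/
theorem exists_isModeSolution (c : ℝ) (a b : ℂ) :
    ∃ v w, IsModeSolution c v w ∧ v 1 = a ∧ w 1 = b := by
  obtain ⟨r, hr⟩ := IsAlgClosed.exists_pow_nat_eq (c : ℂ) two_pos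
  have hE : ContDiff ℝ ∞ fun x : ℝ => r * ((x : ℂ) - 1) :=
    contDiff_const.mul (Complex.ofRealCLM.contDiff.sub contDiff_const)
  have hX : ∀ x : ℝ, HasDerivAt (fun x : ℝ => (x : ℂ) - 1) 1 x := fun x =>
    Complex.ofRealCLM.hasDerivAt.sub_const 1
  have hD : ∀ x : ℝ, HasDerivAt (fun x : ℝ => r * ((x : ℂ) - 1)) r x := fun x =>
    ((hX x).const_mul r).congr_deriv (by simp)
  have hC : ContDiff ℝ ∞ fun x : ℝ => Complex.cosh (r * ((x : ℂ) - 1)) :=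
    (Complex.contDiff_cosh.restrict_scalars ℝ).comp hE
  have hS : ContDiff ℝ ∞ fun x : ℝ => Complex.sinh (r * ((x : ℂ) - 1)) :=
    (Complex.contDiff_sinh.restrict_scalars ℝ).comp hE
  have dC : ∀ x : ℝ, HasDerivAt (fun x : ℝ => Complex.cosh (r * ((x : ℂ) - 1)))
      (Complex.sinh (r * ((x : ℂ) - 1)) * r) x := fun x =>
    (Complex.hasDerivAt_cosh _).comp x (hD x)
  have dS : ∀ x : ℝ, HasDerivAt (fun x : ℝ => Complex.sinh (r * ((x : ℂ) - 1)))
      (Complex.cosh (r * ((x : ℂ) - 1)) * r) x := fun x =>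
    (Complex.hasDerivAt_sinh _).comp x (hD x)
  rcases eq_or_ne r 0 with h0 | h0
  · have hc : (c : ℂ) = 0 := by rw [← hr, h0]; simp
    refine ⟨fun x => a + b * ((x : ℂ) - 1), fun _ => b, ⟨contDiff_const.add (contDiff_const.mul
      (Complex.ofRealCLM.contDiff.sub contDiff_const)), contDiff_const, fun x => ?_, fun x => ?_⟩,
      by simp, rfl⟩
    · exact (((hX x).const_mul b).const_add a).congr_deriv (by simp)
    · exact (hasDerivAt_const x b).congr_deriv (by simp [hc])
  · refine ⟨fun x =>
        a * Complex.cosh (r * ((x : ℂ) - 1)) + b / r * Complex.sinh (r * ((x : ℂ) - 1)),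
      fun x => a * r * Complex.sinh (r * ((x : ℂ) - 1)) + b * Complex.cosh (r * ((x : ℂ) - 1)),
      ⟨(contDiff_const.mul hC).add (contDiff_const.mul hS),
        (contDiff_const.mul hS).add (contDiff_const.mul hC), fun x => ?_, fun x => ?_⟩,
      by simp, by simp⟩
    · exact (((dC x).const_mul a).add ((dS x).const_mul (b / r))).congr_deriv (by field_simp)
    · refine (((dS x).const_mul (a * r)).add ((dC x).const_mul b)).congr_deriv ?_
      rw [← hr]; field_simp

/-- A Wronskian argument: the Wronskian with any second solution is constant, hence zero. The Cauchy
data at `1` of the second solution are chosen so that the Wronskian there is `|v(1)|² + |w(1)|²`. -/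
theorem IsModeSolution.eq_zero_of_left {c : ℝ} {v w : ℝ → ℂ} (h : IsModeSolution c v w)
    (h0 : v 0 = 0) (h0' : w 0 = 0) : v 1 = 0 ∧ w 1 = 0 := by
  obtain ⟨u, z, hu, hu1, hz1⟩ := exists_isModeSolution c (-conj (w 1)) (conj (v 1))
  have hd : ∀ x, HasDerivAt (fun x => v x * z x - w x * u x) 0 x := fun x =>
    (((h.3 x).mul (hu.4 x)).sub ((h.4 x).mul (hu.3 x))).congr_deriv (by ring)
  have := is_const_of_deriv_eq_zero (fun x => (hd x).differentiableAt) (fun x => (hd x).deriv) 0 1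
  simp only [h0, h0', hu1, hz1, mul_neg, sub_neg_eq_add, Complex.mul_conj, zero_mul, sub_zero]
    at this
  norm_cast at this
  have h1 := Complex.normSq_nonneg (v 1)
  have h2 := Complex.normSq_nonneg (w 1)
  exact ⟨Complex.normSq_eq_zero.1 (by linarith), Complex.normSq_eq_zero.1 (by linarith)⟩

theorem exists_normalized_isModeSolution {k : ℝ} (hk : 0 < k) (l : ℝ) (β : BoundaryOperator) :
    ∃ v w, IsModeSolution (l - k ^ 2) v w ∧ β.rightCondition k (v 1) (w 1) ∧
      -w 0 - Complex.I * k * v 0 = 1 := by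
  -- Nontrivial Cauchy data compatible with `β` are prescribed at `1`. The impedance value `q` at
  -- `0` is then nonzero, and dividing by it normalises the solution.
  obtain ⟨a, b, hab, hne⟩ : ∃ a b : ℂ, β.rightCondition k a b ∧ ¬ (a = 0 ∧ b = 0) := by
    cases β
    · exact ⟨0, 1, rfl, by simp⟩
    · exact ⟨1, 0, rfl, by simp⟩
    · exact ⟨1, Complex.I * k * 1, rfl, by simp⟩
  obtain ⟨v, w, h, rfl, rfl⟩ := exists_isModeSolution (l - k ^ 2) a b
  set q := -w 0 - Complex.I * k * v 0 with hq
  have hq0 : q ≠ 0 := by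
    intro hq0
    have h1 := h.norm_sq_add_le hk hab
    rw [← hq, hq0, norm_zero] at h1
    have h2 : 0 ≤ k ^ 2 * ‖v 0‖ ^ 2 := by positivity
    have h3 : ‖w 0‖ ^ 2 = 0 := le_antisymm (by linarith) (by positivity)
    have h4 : k ^ 2 * ‖v 0‖ ^ 2 = 0 := le_antisymm (by nlinarith [sq_nonneg ‖w 0‖]) h2
    refine hne (h.eq_zero_of_left ?_ ?_)
    · simpa [hk.ne'] using h4
    · simpa using h3
  refine ⟨fun x => q⁻¹ * v x, fun x => q⁻¹ * w x, ⟨contDiff_const.mul h.1, contDiff_const.mul h.2,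
    fun x => (h.3 x).const_mul _, fun x => ((h.4 x).const_mul _).congr_deriv (by ring)⟩, ?_, ?_⟩
  · have h00 : β.rightCondition k 0 0 := by
      cases β <;> simp [BoundaryOperator.rightCondition]
    simpa using h00.add_mul hab q⁻¹
  · rw [← inv_mul_cancel₀ hq0, hq]; ring

/-- The inhomogeneous separated equation with exponential right-hand side and homogeneous
boundary conditions is solvable. -/
theorem exists_modeSolution_exp {k : ℝ} (hk : 0 < k) (l : ℝ) (β : BoundaryOperator) {s : ℂ}
    (hs : s ^ 2 ≠ ((l - k ^ 2 : ℝ) : ℂ)) :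
    ∃ v w : ℝ → ℂ, ContDiff ℝ ∞ v ∧ ContDiff ℝ ∞ w ∧ (∀ x, HasDerivAt v (w x) x) ∧
      (∀ x, HasDerivAt w (((l - k ^ 2 : ℝ) : ℂ) * v x - Complex.exp (s * x)) x) ∧
      β.rightCondition k (v 1) (w 1) ∧ -w 0 - Complex.I * k * v 0 = 0 := by
  set c : ℝ := l - k ^ 2 with hc
  have hd : s ^ 2 - (c : ℂ) ≠ 0 := sub_ne_zero.2 hs
  set d := (s ^ 2 - (c : ℂ))⁻¹ with hdd
  obtain ⟨v₀, w₀, h₀, hβ, hq⟩ := exists_normalized_isModeSolution hk l β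
  -- `v₁` cancels the Cauchy data at `1` of the particular solution `-d e^{sx}`, so the sum
  -- satisfies every possible condition there. A multiple `A` of the normalised solution then
  -- corrects the impedance value at `0` without disturbing `β`.
  obtain ⟨v₁, w₁, h₁, hv₁, hw₁⟩ := exists_isModeSolution c (d * Complex.exp s)
    (d * s * Complex.exp s)
  have hE : ContDiff ℝ ∞ fun x : ℝ => Complex.exp (s * x) :=
    ((Complex.contDiff_exp (𝕜 := ℂ)).restrict_scalars ℝ).comp
      (contDiff_const.mul Complex.ofRealCLM.contDiff)
  have dE : ∀ x : ℝ, HasDerivAt (fun x : ℝ => Complex.exp (s * x)) (Complex.exp (s * x) * s) x :=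
    fun x => (Complex.hasDerivAt_exp _).comp x
      ((Complex.ofRealCLM.hasDerivAt.const_mul s).congr_deriv (by simp))
  set A : ℂ := -(-(w₁ 0 - d * s) - Complex.I * k * (v₁ 0 - d)) with hA
  refine ⟨fun x => (v₁ x - d * Complex.exp (s * x)) + A * v₀ x,
    fun x => (w₁ x - d * s * Complex.exp (s * x)) + A * w₀ x,
    (h₁.1.sub (contDiff_const.mul hE)).add (contDiff_const.mul h₀.1),
    (h₁.2.sub (contDiff_const.mul hE)).add (contDiff_const.mul h₀.2), fun x => ?_, fun x => ?_,
    ?_, ?_⟩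
  · exact (((h₁.3 x).sub ((dE x).const_mul d)).add ((h₀.3 x).const_mul A)).congr_deriv (by ring)
  · refine (((h₁.4 x).sub ((dE x).const_mul (d * s))).add
      ((h₀.4 x).const_mul A)).congr_deriv ?_
    have : d * (s ^ 2 - c) = 1 := inv_mul_cancel₀ hd
    linear_combination (-Complex.exp (s * x)) * this
  · have h00 : β.rightCondition k 0 0 := by
      cases β <;> simp [BoundaryOperator.rightCondition]
    have := h00.add_mul hβ A
    simpa [hv₁, hw₁] using this
  · simp only [Complex.ofReal_zero, mul_zero, Complex.exp_zero, mul_one]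
    linear_combination A * hq

/-! ### Transverse modes -/

/-- The functions `y ↦ sin (α n * y + θ)` are the eigenfunctions of `-d²/dy²` on `(0,1)` with the
boundary conditions `b` at `0` and `t` at `1` (read as Neumann unless Dirichlet). -/
structure IsModeFamily (b t : BoundaryOperator) (α : ℕ → ℝ) (θ : ℝ) : Prop where
  sq_injective : ∀ n m, α n ^ 2 = α m ^ 2 → n = m
  gap : ∀ n, α n ^ 2 = 0 ∨ 2 ≤ α n ^ 2
  bottom_dirichlet : b = .dirichlet → Real.sin θ = 0
  bottom_neumann : b ≠ .dirichlet → ∀ n, α n * Real.cos θ = 0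
  top_dirichlet : t = .dirichlet → ∀ n, Real.sin (α n + θ) = 0
  top_neumann : t ≠ .dirichlet → ∀ n, α n * Real.cos (α n + θ) = 0
  succ : ∀ n, α (n + 1) = α n + Real.pi
  base : ∃ c d : ℝ, ∀ y, Real.sin (α 0 * y + θ) * Real.cos (Real.pi * y)
    = c * Real.sin (α 0 * y + θ) + d * Real.sin (α 1 * y + θ)
  ne_zero : ∀ y ∈ Ioo (0 : ℝ) 1, Real.sin (α 0 * y + θ) ≠ 0

theorem sq_injective_of_shift {s : ℝ} (hs : 0 ≤ s) (n m : ℕ)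
    (h : (((n : ℝ) + s) * Real.pi) ^ 2 = (((m : ℝ) + s) * Real.pi) ^ 2) : n = m := by
  have h1 := (sq_eq_sq₀ (by positivity) (by positivity)).1 h
  have h2 := mul_right_cancel₀ Real.pi_ne_zero h1
  exact_mod_cast add_right_cancel h2

theorem gap_of_shift {s : ℝ} (hs : 1 / 2 ≤ s) (n : ℕ) :
    2 ≤ (((n : ℝ) + s) * Real.pi) ^ 2 := by
  have h1 : (1 / 2 : ℝ) * 3 ≤ ((n : ℝ) + s) * Real.pi := by
    have := Real.pi_gt_three
    have : (0 : ℝ) ≤ n := by positivity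
    exact mul_le_mul (by linarith) (by linarith) (by norm_num) (by linarith)
  nlinarith

/-- The four families are `sin (n+1)πy`, `sin (n+½)πy`, `cos (n+½)πy` and `cos nπy`, in the order
Dirichlet–Dirichlet, Dirichlet–Neumann, Neumann–Dirichlet, Neumann–Neumann. The coefficients in
`base` come from `φ_0 cos πy = (φ_{-1} + φ_1)/2`, where `φ_{-1}` is respectively `0`, `-φ_0`, `φ_0`,
`φ_1`. -/
theorem exists_isModeFamily (b t : BoundaryOperator) : ∃ α θ, IsModeFamily b t α θ := by
  have hpi := Real.pi_pos
  by_cases hb : b = .dirichlet <;> by_cases ht : t = .dirichlet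
  · refine ⟨fun n => (n + 1) * Real.pi, 0, sq_injective_of_shift zero_le_one,
      fun n => Or.inr (gap_of_shift (by norm_num) n), by simp, fun h => absurd hb h,
      fun _ n => ?_, fun h => absurd ht h, fun n => by push_cast; ring, ⟨0, 1 / 2, fun y => ?_⟩,
      fun y hy => ?_⟩
    · simpa using Real.sin_nat_mul_pi (n + 1)
    · have : ((((1 : ℕ) : ℝ) + 1) * Real.pi * y + 0) = 2 * (Real.pi * y) := by push_cast; ring
      rw [this, Real.sin_two_mul]
      simp
      ring
    · refine (Real.sin_pos_of_pos_of_lt_pi ?_ ?_).ne' <;> simp <;> nlinarith [hy.1, hy.2]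
  · refine ⟨fun n => (n + 1 / 2) * Real.pi, 0, sq_injective_of_shift (by norm_num),
      fun n => Or.inr (gap_of_shift le_rfl n), by simp, fun h => absurd hb h,
      fun h => absurd h ht, fun _ n => ?_, fun n => by push_cast; ring,
      ⟨-1 / 2, 1 / 2, fun y => ?_⟩, fun y hy => ?_⟩
    · rw [show ((n : ℝ) + 1 / 2) * Real.pi + 0 = n * Real.pi + Real.pi / 2 by ring,
        Real.cos_add_pi_div_two, Real.sin_nat_mul_pi]
      simp
    · rw [show ((((1 : ℕ) : ℝ) + 1 / 2) * Real.pi * y + 0)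
          = ((((0 : ℕ) : ℝ) + 1 / 2) * Real.pi * y + 0) + Real.pi * y by push_cast; ring]
      have h1 := Real.sin_sub (Real.pi * y) ((((0 : ℕ) : ℝ) + 1 / 2) * Real.pi * y + 0)
      rw [show Real.pi * y - ((((0 : ℕ) : ℝ) + 1 / 2) * Real.pi * y + 0)
          = ((((0 : ℕ) : ℝ) + 1 / 2) * Real.pi * y + 0) by push_cast; ring] at h1
      have h2 := Real.sin_add ((((0 : ℕ) : ℝ) + 1 / 2) * Real.pi * y + 0) (Real.pi * y)
      linear_combination (1 / 2 : ℝ) * h1 - (1 / 2 : ℝ) * h2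
    · refine (Real.sin_pos_of_pos_of_lt_pi ?_ ?_).ne' <;> simp <;> nlinarith [hy.1, hy.2]
  · refine ⟨fun n => (n + 1 / 2) * Real.pi, Real.pi / 2, sq_injective_of_shift (by norm_num),
      fun n => Or.inr (gap_of_shift le_rfl n), fun h => absurd h hb, by simp,
      fun _ n => ?_, fun h => absurd ht h, fun n => by push_cast; ring,
      ⟨1 / 2, 1 / 2, fun y => ?_⟩, fun y hy => ?_⟩
    · rw [show ((n : ℝ) + 1 / 2) * Real.pi + Real.pi / 2 = ((n + 1 : ℕ) : ℝ) * Real.pi by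
        push_cast; ring, Real.sin_nat_mul_pi]
    · simp only [Real.sin_add_pi_div_two]
      rw [show ((((1 : ℕ) : ℝ) + 1 / 2) * Real.pi * y)
          = ((((0 : ℕ) : ℝ) + 1 / 2) * Real.pi * y) + Real.pi * y by push_cast; ring,
        Real.cos_add]
      have := Real.cos_sub (Real.pi * y) ((((0 : ℕ) : ℝ) + 1 / 2) * Real.pi * y)
      rw [show Real.pi * y - ((((0 : ℕ) : ℝ) + 1 / 2) * Real.pi * y)
          = ((((0 : ℕ) : ℝ) + 1 / 2) * Real.pi * y) by push_cast; ring] at this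
      linear_combination (-1 / 2 : ℝ) * this
    · rw [Real.sin_add_pi_div_two]
      refine (Real.cos_pos_of_mem_Ioo ⟨?_, ?_⟩).ne' <;> simp <;> nlinarith [hy.1, hy.2]
  · refine ⟨fun n => (n + 0) * Real.pi, Real.pi / 2, sq_injective_of_shift le_rfl,
      fun n => ?_, fun h => absurd h hb, by simp,
      fun h => absurd h ht, fun _ n => ?_, fun n => by push_cast; ring,
      ⟨0, 1, fun y => ?_⟩, fun y hy => ?_⟩
    · rcases n with _ | n
      · simp
      · right
        simpa using gap_of_shift (s := 1) (by norm_num) n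
    · rw [add_zero, Real.cos_add_pi_div_two, Real.sin_nat_mul_pi]
      simp
    · simp [Real.sin_add_pi_div_two]
    · simp

section Orthogonality

variable {b t : BoundaryOperator} {α : ℕ → ℝ} {θ : ℝ}

theorem IsModeFamily.flux_eq_zero (h : IsModeFamily b t α θ) (n m : ℕ) :
    α n * Real.cos θ * Real.sin θ = 0 ∧ α n * Real.cos (α n + θ) * Real.sin (α m + θ) = 0 := by
  constructor
  · by_cases hb : b = .dirichlet
    · rw [h.bottom_dirichlet hb, mul_zero]
    · rw [h.bottom_neumann hb, zero_mul]
  · by_cases ht : t = .dirichlet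
    · rw [h.top_dirichlet ht, mul_zero]
    · rw [h.top_neumann ht, zero_mul]

theorem hasDerivAt_sin_mode (a θ y : ℝ) :
    HasDerivAt (fun y => Real.sin (a * y + θ)) (a * Real.cos (a * y + θ)) y :=
  (((hasDerivAt_id y).const_mul a).add_const θ).sin.congr_deriv (by simp; ring)

theorem hasDerivAt_cos_mode (a θ y : ℝ) :
    HasDerivAt (fun y => a * Real.cos (a * y + θ)) (-(a ^ 2 * Real.sin (a * y + θ))) y :=
  ((((hasDerivAt_id y).const_mul a).add_const θ).cos.const_mul a).congr_deriv (by simp; ring)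

/-- Integration by parts, with boundary terms killed by the end conditions. The left side is
symmetric in `n` and `m`, so distinct `α_n²` make both the modes and their derivatives orthogonal.
-/
theorem IsModeFamily.integral_deriv_mul_deriv (h : IsModeFamily b t α θ) (n m : ℕ) :
    ∫ y, (α n * Real.cos (α n * y + θ)) * (α m * Real.cos (α m * y + θ)) ∂sideMeasure
      = α n ^ 2 * ∫ y, Real.sin (α n * y + θ) * Real.sin (α m * y + θ) ∂sideMeasure := by
  rw [integral_sideMeasure, integral_sideMeasure, ← intervalIntegral.integral_const_mul,
    ← sub_eq_zero, ← intervalIntegral.integral_sub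
    (Continuous.intervalIntegrable (by fun_prop) _ _)
    (Continuous.intervalIntegrable (by fun_prop) _ _)]
  rw [intervalIntegral.integral_eq_sub_of_hasDerivAt
    (f := fun y => α n * Real.cos (α n * y + θ) * Real.sin (α m * y + θ)) (fun y _ =>
      ((hasDerivAt_cos_mode _ _ _).mul (hasDerivAt_sin_mode _ _ _)).congr_deriv (by ring))
    (Continuous.intervalIntegrable (by fun_prop) _ _)]
  obtain ⟨h1, h2⟩ := h.flux_eq_zero n m
  simp [h1, h2]

theorem IsModeFamily.orthogonal (h : IsModeFamily b t α θ) {n m : ℕ} (hnm : n ≠ m) :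
    ∫ y, Real.sin (α n * y + θ) * Real.sin (α m * y + θ) ∂sideMeasure = 0 := by
  have h1 := h.integral_deriv_mul_deriv n m
  have h2 := h.integral_deriv_mul_deriv m n
  simp only [mul_comm (α m * Real.cos _), mul_comm (Real.sin (α m * _ + _))] at h2
  rw [h1] at h2
  by_contra hne
  exact hnm (h.sq_injective _ _ (mul_right_cancel₀ hne h2))

theorem IsModeFamily.orthogonal_deriv (h : IsModeFamily b t α θ) {n m : ℕ} (hnm : n ≠ m) :
    ∫ y, (α n * Real.cos (α n * y + θ)) * (α m * Real.cos (α m * y + θ)) ∂sideMeasure = 0 := by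
  rw [h.integral_deriv_mul_deriv, h.orthogonal hnm, mul_zero]

end Orthogonality

/-! ### Totality of separated functions -/

/-- Stone–Weierstrass on the closed square: `p` and `q` separate points, so their monomials span a
dense subspace of the continuous functions, and the integral against `G` vanishes on all of them. -/
theorem ae_eq_zero_of_integral_pow_mul_pow {G : ℝ × ℝ → ℂ} (hG : Integrable G squareMeasure)
    {p q : ℝ × ℝ → ℝ} (hp : Continuous p) (hq : Continuous q)
    (hinj : ∀ z ∈ Icc (0 : ℝ) 1 ×ˢ Icc (0 : ℝ) 1, ∀ w ∈ Icc (0 : ℝ) 1 ×ˢ Icc (0 : ℝ) 1,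
      p z = p w → q z = q w → z = w)
    (h : ∀ i j : ℕ, ∫ z, (p z ^ i * q z ^ j) • G z ∂squareMeasure = 0) :
    G =ᵐ[squareMeasure] 0 := by
  let ι : unitInterval × unitInterval → ℝ × ℝ := fun z => (z.1, z.2)
  have hι : Continuous ι := by fun_prop
  -- A retraction onto the closed square, so that functions on the compact square can be integrated
  -- against a measure on the plane.
  let r : ℝ × ℝ → unitInterval × unitInterval := fun z =>
    (projIcc 0 1 zero_le_one z.1, projIcc 0 1 zero_le_one z.2)
  have hr : Continuous r :=
    (continuous_projIcc.comp continuous_fst).prodMk (continuous_projIcc.comp continuous_snd)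
  have hιr : ∀ᵐ z ∂squareMeasure, ι (r z) = z := by
    filter_upwards [ae_mem_squareMeasure] with z hz
    simp only [ι, r]
    rw [projIcc_of_mem _ (Ioo_subset_Icc_self hz.1), projIcc_of_mem _ (Ioo_subset_Icc_self hz.2)]
  let P : C(unitInterval × unitInterval, ℝ) := ⟨p ∘ ι, hp.comp hι⟩
  let Q : C(unitInterval × unitInterval, ℝ) := ⟨q ∘ ι, hq.comp hι⟩
  let A : Subalgebra ℝ C(unitInterval × unitInterval, ℝ) := Algebra.adjoin ℝ {P, Q}
  have hsep : A.SeparatesPoints := by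
    intro x y hxy
    by_cases hP : P x = P y
    · refine ⟨Q, ⟨Q, Algebra.subset_adjoin (by simp), rfl⟩, fun hQ => hxy ?_⟩
      have := hinj (ι x) ⟨x.1.2, x.2.2⟩ (ι y) ⟨y.1.2, y.2.2⟩ hP hQ
      simp only [ι, Prod.mk.injEq] at this
      exact Prod.ext (Subtype.ext this.1) (Subtype.ext this.2)
    · exact ⟨P, ⟨P, Algebra.subset_adjoin (by simp), rfl⟩, hP⟩
  have hint : ∀ f : C(unitInterval × unitInterval, ℝ),
      Integrable (fun z => f (r z) • G z) squareMeasure := fun f =>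
    hG.bdd_smul ‖f‖ (f.continuous.comp hr).aestronglyMeasurable
      (Eventually.of_forall fun z => f.norm_coe_le_norm _)
  have hA : ∀ f ∈ A, ∫ z, f (r z) • G z ∂squareMeasure = 0 := by
    intro f hf
    have hf' : f ∈ Submodule.span ℝ (Submonoid.closure {P, Q} : Set C(_, ℝ)) := by
      rw [← Algebra.adjoin_eq_span]; exact hf
    induction hf' using Submodule.span_induction with
    | mem f hf' =>
      obtain ⟨i, j, rfl⟩ := (Submonoid.mem_closure_pair P Q f).1 hf'
      rw [← h i j]
      refine integral_congr_ae (hιr.mono fun z hz => ?_)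
      simp [P, Q, hz]
    | zero => simp
    | add f g hf' hg' h1 h2 =>
      have m1 : f ∈ A := by
        change f ∈ Subalgebra.toSubmodule A; rw [Algebra.adjoin_eq_span]; exact hf'
      have m2 : g ∈ A := by
        change g ∈ Subalgebra.toSubmodule A; rw [Algebra.adjoin_eq_span]; exact hg'
      simp only [ContinuousMap.add_apply, add_smul]
      rw [integral_add (hint f) (hint g), h1 m1, h2 m2, add_zero]
    | smul c f hf' h1 =>
      have m1 : f ∈ A := by
        change f ∈ Subalgebra.toSubmodule A; rw [Algebra.adjoin_eq_span]; exact hf'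
      simp only [ContinuousMap.smul_apply, smul_assoc]
      rw [integral_smul, h1 m1, smul_zero]
  have hall : ∀ f : C(unitInterval × unitInterval, ℝ),
      ∫ z, f (r z) • G z ∂squareMeasure = 0 := by
    intro f
    set C := ∫ z, ‖G z‖ ∂squareMeasure with hC
    have hC0 : 0 ≤ C := integral_nonneg fun _ => norm_nonneg _
    rw [← norm_le_zero_iff]
    refine le_of_forall_pos_le_add fun ε hε => ?_
    obtain ⟨a, ha⟩ := ContinuousMap.exists_mem_subalgebra_near_continuousMap_of_separatesPoints A
      hsep f (ε / (C + 1)) (by positivity)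
    have h1 : ∫ z, f (r z) • G z ∂squareMeasure
        = ∫ z, (f - a : C(unitInterval × unitInterval, ℝ)) (r z) • G z ∂squareMeasure := by
      simp only [ContinuousMap.sub_apply, sub_smul]
      rw [integral_sub (hint f) (hint a), hA a a.2, sub_zero]
    rw [h1]
    calc ‖∫ z, (f - a : C(unitInterval × unitInterval, ℝ)) (r z) • G z ∂squareMeasure‖
        ≤ ∫ z, ε / (C + 1) * ‖G z‖ ∂squareMeasure := by
          refine norm_integral_le_of_norm_le (hG.norm.const_mul _)
            (Eventually.of_forall fun z => ?_)
          rw [norm_smul]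
          gcongr
          refine ((f - a : C(unitInterval × unitInterval, ℝ)).norm_coe_le_norm _).trans ?_
          rw [norm_sub_rev]
          exact ha.le
      _ = ε / (C + 1) * C := integral_const_mul _ _
      _ ≤ ε / (C + 1) * (C + 1) := by gcongr; linarith
      _ = 0 + ε := by rw [div_mul_cancel₀ _ (by positivity), zero_add]
  refine ae_eq_zero_of_integral_contDiff_smul_eq_zero hG.locallyIntegrable fun g hg _ => ?_
  rw [← hall ⟨g ∘ ι, hg.continuous.comp hι⟩]
  refine integral_congr_ae (hιr.mono fun z hz => ?_)
  simp [hz]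

theorem Complex.one_add_nat_add_I_sq_ne (j : ℕ) (c : ℝ) :
    (1 + (j : ℂ) + Complex.I) ^ 2 ≠ (c : ℂ) := by
  intro h
  have := congrArg Complex.im h
  simp [pow_two] at this
  have hj : (0 : ℝ) ≤ j := by positivity
  linarith

/-- Multiplication by `cos πy` preserves the span of the `φ_n`, so `f` also annihilates `e^{sx} φ_0
cos^m πy`. Thus `f e^{(1+i)x} φ_0` has vanishing moments against monomials in `e^x` and `cos πy`,
which separate the points of the closed square. The factor `e^{(1+i)x} φ_0` has no zero inside and
can be divided out. -/
theorem IsModeFamily.ae_eq_zero {b t : BoundaryOperator} {α : ℕ → ℝ} {θ : ℝ}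
    (hα : IsModeFamily b t α θ) {f : ℝ × ℝ → ℂ} (hf : MemLp f 2 squareMeasure)
    (h : ∀ j n : ℕ, ∫ z, f z * (Complex.exp ((1 + (j : ℂ) + Complex.I) * z.1)
      * Real.sin (α n * z.2 + θ)) ∂squareMeasure = 0) :
    f =ᵐ[squareMeasure] 0 := by
  have hint : ∀ w : ℝ × ℝ → ℂ, Continuous w → Integrable (fun z => f z * w z) squareMeasure :=
    fun w hw => hf.integrable_mul_two hw.memLp_squareMeasure
  have hcos : ∀ m j n : ℕ, ∫ z, f z * (Complex.exp ((1 + (j : ℂ) + Complex.I) * z.1)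
      * (Real.sin (α n * z.2 + θ) * Real.cos (Real.pi * z.2) ^ m : ℝ)) ∂squareMeasure = 0 := by
    intro m
    induction m with
    | zero => intro j n; simpa using h j n
    | succ m ih =>
      intro j n
      obtain ⟨i₁, i₂, c, d, hcd⟩ : ∃ (i₁ i₂ : ℕ) (c d : ℝ), ∀ y,
          Real.sin (α n * y + θ) * Real.cos (Real.pi * y)
            = c * Real.sin (α i₁ * y + θ) + d * Real.sin (α i₂ * y + θ) := by
        rcases n with _ | n
        · obtain ⟨c, d, hcd⟩ := hα.base
          exact ⟨0, 1, c, d, hcd⟩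
        · refine ⟨n, n + 2, 1 / 2, 1 / 2, fun y => ?_⟩
          have h1 := Real.sin_sub (α (n + 1) * y + θ) (Real.pi * y)
          have h2 := Real.sin_add (α (n + 1) * y + θ) (Real.pi * y)
          rw [show (α (n + 1) * y + θ) - Real.pi * y = α n * y + θ by rw [hα.succ]; ring] at h1
          rw [show (α (n + 1) * y + θ) + Real.pi * y = α (n + 2) * y + θ by
            rw [hα.succ (n + 1)]; ring] at h2
          linear_combination (-1 / 2 : ℝ) * h1 - (1 / 2 : ℝ) * h2
      have e : ∀ z : ℝ × ℝ, f z * (Complex.exp ((1 + (j : ℂ) + Complex.I) * z.1)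
          * (Real.sin (α n * z.2 + θ) * Real.cos (Real.pi * z.2) ^ (m + 1) : ℝ))
          = c * (f z * (Complex.exp ((1 + (j : ℂ) + Complex.I) * z.1)
            * (Real.sin (α i₁ * z.2 + θ) * Real.cos (Real.pi * z.2) ^ m : ℝ)))
          + d * (f z * (Complex.exp ((1 + (j : ℂ) + Complex.I) * z.1)
            * (Real.sin (α i₂ * z.2 + θ) * Real.cos (Real.pi * z.2) ^ m : ℝ))) := by
        intro z
        rw [pow_succ', ← mul_assoc (Real.sin _), hcd]
        push_cast; ring
      simp only [e]
      rw [integral_add ((hint _ (by fun_prop)).const_mul _) ((hint _ (by fun_prop)).const_mul _),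
        integral_const_mul, integral_const_mul, ih, ih]
      simp
  have hG := ae_eq_zero_of_integral_pow_mul_pow (p := fun z => Real.exp z.1)
    (q := fun z => Real.cos (Real.pi * z.2))
    (hint (fun z => Complex.exp ((1 + Complex.I) * z.1) * Real.sin (α 0 * z.2 + θ)) (by fun_prop))
    (by fun_prop) (by fun_prop) (fun z hz w hw h1 h2 => by
      refine Prod.ext (Real.exp_injective h1) ?_
      have hpi := Real.pi_pos
      have := Real.injOn_cos ⟨by nlinarith [hz.2.1], by nlinarith [hz.2.2]⟩
        ⟨by nlinarith [hw.2.1], by nlinarith [hw.2.2]⟩ h2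
      exact mul_left_cancel₀ hpi.ne' this) (fun i j => by
      rw [← hcos j i 0]
      congr 1 with z
      rw [show (1 + (i : ℂ) + Complex.I) * z.1 = (1 + Complex.I) * z.1 + i * z.1 by ring,
        Complex.exp_add, Complex.exp_nat_mul, Complex.real_smul]
      push_cast; ring)
  filter_upwards [hG, ae_mem_squareMeasure] with z hz hmem
  have h1 : (Real.sin (α 0 * z.2 + θ) : ℂ) ≠ 0 := by exact_mod_cast hα.ne_zero _ hmem.2
  simpa [h1, Complex.exp_ne_zero, -Complex.ofReal_sin] using hz

/-! ### Smooth functions as elements of `H¹` -/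

theorem eq_zero_of_tsupport_subset_unitSquare {φ : ℝ × ℝ → ℂ} (h : tsupport φ ⊆ unitSquare)
    {z : ℝ × ℝ} (hz : z ∉ unitSquare) : φ z = 0 :=
  image_eq_zero_of_notMem_tsupport fun h' => hz (h h')

theorem ContDiff.memH1 {F : ℝ × ℝ → ℂ} (hF : ContDiff ℝ ∞ F) :
    MemH1 F (fun z => fderiv ℝ F z (1, 0)) (fun z => fderiv ℝ F z (0, 1)) := by
  refine ⟨hF.continuous.memLp_squareMeasure, (hF.continuous_fderiv_dir _).memLp_squareMeasure,
    (hF.continuous_fderiv_dir _).memLp_squareMeasure, fun φ hφ _ hsupp => ?_⟩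
  have h0 : ∀ y : ℝ, φ (0, y) = 0 ∧ φ (1, y) = 0 ∧ φ (y, 0) = 0 ∧ φ (y, 1) = 0 := fun y => by
    refine ⟨?_, ?_, ?_, ?_⟩ <;>
      exact eq_zero_of_tsupport_subset_unitSquare hsupp (by simp [unitSquare])
  have h1 := integral_fderiv_fst (hF.mul hφ)
  have h2 := integral_fderiv_snd (hF.mul hφ)
  simp only [fderiv_mul_dir hF hφ, h0, mul_zero, integral_zero, sub_self] at h1 h2
  have i : ∀ e, Integrable (fun z => φ z * fderiv ℝ F z e) squareMeasure := fun e =>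
    (hφ.continuous.mul (hF.continuous_fderiv_dir e)).integrable_squareMeasure
  have j : ∀ e, Integrable (fun z => fderiv ℝ φ z e * F z) squareMeasure := fun e =>
    ((hφ.continuous_fderiv_dir e).mul hF.continuous).integrable_squareMeasure
  rw [integral_add (i _) (j _)] at h1 h2
  constructor
  · simp only [mul_comm (F _), mul_comm (fderiv ℝ F _ _)]
    linear_combination h1
  · simp only [mul_comm (F _), mul_comm (fderiv ℝ F _ _)]
    linear_combination h2

theorem ContDiff.hasTrace {F : ℝ × ℝ → ℂ} (hF : ContDiff ℝ ∞ F) (s : Side) :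
    HasTrace F (fun z => fderiv ℝ F z (1, 0)) (fun z => fderiv ℝ F z (0, 1)) s
      (fun y => F (s.point y)) :=
  ⟨(hF.continuous.comp s.continuous_point).memLp_sideMeasure, fun _ => F, fun _ => hF, by simp,
    by simp, by simp, by simp⟩

theorem ContDiff.complex_conj {F : ℝ × ℝ → ℂ} (hF : ContDiff ℝ ∞ F) :
    ContDiff ℝ ∞ fun z => conj (F z) :=
  Complex.conjCLE.contDiff.comp hF

theorem fderiv_complex_conj {F : ℝ × ℝ → ℂ} (hF : ContDiff ℝ ∞ F) (z e : ℝ × ℝ) :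
    fderiv ℝ (fun z => conj (F z)) z e = conj (fderiv ℝ F z e) := by
  have h := (Complex.conjCLE.hasFDerivAt (x := F z)).comp z
    (hF.differentiable (by simp) z).hasFDerivAt
  rw [show (fun z => conj (F z)) = Complex.conjCLE ∘ F from rfl, h.fderiv]
  simp

/-! ### Separated functions -/

/-- The separated function `(x, y) ↦ a x * b y`. -/
def separated (a : ℝ → ℂ) (b : ℝ → ℝ) (z : ℝ × ℝ) : ℂ := a z.1 * b z.2

theorem contDiff_separated {a : ℝ → ℂ} {b : ℝ → ℝ} (ha : ContDiff ℝ ∞ a) (hb : ContDiff ℝ ∞ b) :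
    ContDiff ℝ ∞ (separated a b) :=
  (ha.comp contDiff_fst).mul (Complex.ofRealCLM.contDiff.comp (hb.comp contDiff_snd))

theorem continuous_separated {a : ℝ → ℂ} {b : ℝ → ℝ} (ha : Continuous a) (hb : Continuous b) :
    Continuous (separated a b) := by
  unfold separated; fun_prop

theorem hasFDerivAt_separated {a a' : ℝ → ℂ} {b b' : ℝ → ℝ} (ha : ∀ x, HasDerivAt a (a' x) x)
    (hb : ∀ y, HasDerivAt b (b' y) y) (z : ℝ × ℝ) :
    HasFDerivAt (separated a b) ((ContinuousLinearMap.fst ℝ ℝ ℝ).smulRight (separated a' b z)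
      + (ContinuousLinearMap.snd ℝ ℝ ℝ).smulRight (separated a b' z)) z := by
  have h1 : HasFDerivAt (fun z : ℝ × ℝ => a z.1) _ z :=
    (ha z.1).hasFDerivAt.comp z hasFDerivAt_fst
  have h2 : HasFDerivAt (fun z : ℝ × ℝ => (b z.2 : ℂ)) _ z :=
    (hb z.2).ofReal_comp.hasFDerivAt.comp z hasFDerivAt_snd
  refine (h1.mul h2).congr_fderiv ?_
  ext <;> (simp [separated]; try ring)

theorem fderiv_separated {a a' : ℝ → ℂ} {b b' : ℝ → ℝ} (ha : ∀ x, HasDerivAt a (a' x) x)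
    (hb : ∀ y, HasDerivAt b (b' y) y) (z : ℝ × ℝ) :
    fderiv ℝ (separated a b) z (1, 0) = separated a' b z ∧
      fderiv ℝ (separated a b) z (0, 1) = separated a b' z := by
  rw [(hasFDerivAt_separated ha hb z).fderiv]
  simp

theorem contDiff_sin_mode (a θ : ℝ) : ContDiff ℝ ∞ fun y => Real.sin (a * y + θ) :=
  Real.contDiff_sin.comp ((contDiff_const.mul contDiff_id).add contDiff_const)

theorem contDiff_cos_mode (a θ : ℝ) : ContDiff ℝ ∞ fun y => a * Real.cos (a * y + θ) :=
  contDiff_const.mul (Real.contDiff_cos.comp ((contDiff_const.mul contDiff_id).add contDiff_const))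

/-! ### Uniqueness -/

theorem Side.sum_univ {M : Type*} [AddCommMonoid M] (f : Side → M) :
    ∑ s, f s = f .bottom + (f .right + (f .top + f .left)) := by
  change ∑ s ∈ ({.bottom, .right, .top, .left} : Finset Side), f s = _
  rw [Finset.sum_insert (by decide), Finset.sum_insert (by decide), Finset.sum_insert (by decide),
    Finset.sum_singleton]

theorem integral_add_sub {β : Type*} [MeasurableSpace β] {μ : Measure β} {f g h : β → ℂ}
    (hf : Integrable f μ) (hg : Integrable g μ) (hh : Integrable h μ) :
    ∫ z, (f z + g z - h z) ∂μ = ∫ z, f z ∂μ + ∫ z, g z ∂μ - ∫ z, h z ∂μ := by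
  rw [← integral_add hf hg]
  exact integral_sub (hf.add hg) hh

theorem integral_mul_eq_zero_of_ae {τ w : ℝ → ℂ} (h : τ =ᵐ[sideMeasure] 0) :
    ∫ y, τ y * w y ∂sideMeasure = 0 := by
  rw [integral_congr_ae (g := fun _ => 0) (h.mono fun y hy => by simp [hy]), integral_zero]

section

variable {k : ℝ} {B : Side → BoundaryOperator} {α : ℕ → ℝ} {θ : ℝ} {g : ℝ → ℂ}

/-- The dual problem. Testing with the conjugate of `v φ_n` makes the weak form bilinear, so `v`
satisfies the same impedance conditions as the solution, not their conjugates. Integrating by parts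
back onto the test function cancels every boundary term except the one with `g`. -/
theorem IsHelmholtzSolution.integral_mul_separated {u ux uy : ℝ × ℝ → ℂ}
    (hB₁ : B .bottom = .dirichlet ∨ B .bottom = .neumann)
    (hB₃ : B .top = .dirichlet ∨ B .top = .neumann) (hB₄ : B .left = .impedance)
    (hα : IsModeFamily (B .bottom) (B .top) α θ)
    (hu : IsHelmholtzSolution k B 0 (leftData g) u ux uy) (n : ℕ) {v w h : ℝ → ℂ}
    (hv : ContDiff ℝ ∞ v) (hw : ContDiff ℝ ∞ w) (hh : Continuous h)
    (hd : ∀ x, HasDerivAt v (w x) x)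
    (hd' : ∀ x, HasDerivAt w (((α n ^ 2 - k ^ 2 : ℝ) : ℂ) * v x - h x) x)
    (hr : (B .right).rightCondition k (v 1) (w 1)) (hl : -w 0 - Complex.I * k * v 0 = 0) :
    ∫ z, u z * (h z.1 * Real.sin (α n * z.2 + θ)) ∂squareMeasure
      = ∫ y, g y * (v 0 * Real.sin (α n * y + θ)) ∂sideMeasure := by
  obtain ⟨hH1, t, htr, htd, hweak⟩ := hu
  set φ : ℝ → ℝ := fun y => Real.sin (α n * y + θ) with hφ
  set ψ : ℝ → ℝ := fun y => α n * Real.cos (α n * y + θ) with hψ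
  have hφc : ContDiff ℝ ∞ φ := contDiff_sin_mode _ _
  have hψc : ContDiff ℝ ∞ ψ := contDiff_cos_mode _ _
  have hF := contDiff_separated hv hφc
  have hFx := contDiff_separated hw hφc
  have hFy := contDiff_separated hv hψc
  have dF : ∀ z, fderiv ℝ (separated v φ) z (1, 0) = separated w φ z ∧
      fderiv ℝ (separated v φ) z (0, 1) = separated v ψ z :=
    fderiv_separated hd (hasDerivAt_sin_mode (α n) θ)
  have dFx : ∀ z, fderiv ℝ (separated w φ) z (1, 0) = _ := fun z =>
    (fderiv_separated hd' (hasDerivAt_sin_mode (α n) θ) z).1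
  have dFy : ∀ z, fderiv ℝ (separated v ψ) z (0, 1) = _ := fun z =>
    (fderiv_separated hd (hasDerivAt_cos_mode (α n) θ) z).2
  have hdir : ∀ s, B s = .dirichlet → t s =ᵐ[sideMeasure] 0 := fun s hs => by
    refine (htd s hs).trans ?_
    cases s
    · rfl
    · rfl
    · rfl
    · rw [hB₄] at hs; cases hs
  have main := hweak _ _ _ _ hF.complex_conj.memH1 (fun s => hF.complex_conj.hasTrace s) (by
    intro s hs
    refine Eventually.of_forall fun y => ?_
    cases s
    · simp [Side.point, separated, hφ, hα.bottom_dirichlet hs]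
    · rw [hs] at hr
      have : v 1 = 0 := hr
      simp [Side.point, separated, this]
    · simp [Side.point, separated, hφ, hα.top_dirichlet hs]
    · rw [hB₄] at hs; cases hs)
  simp only [fderiv_complex_conj hF, Complex.conj_conj, (dF _).1, (dF _).2] at main
  have P1 := integral_by_parts_fst hH1 htr hFx
  have P2 := integral_by_parts_snd hH1 htr hFy
  simp only [dFx] at P1
  simp only [dFy] at P2
  have hs : Continuous (separated v φ) := hF.continuous
  have c1 : Continuous (separated (fun x => ((α n ^ 2 - k ^ 2 : ℝ) : ℂ) * v x - h x) φ) :=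
    continuous_separated ((continuous_const.mul hv.continuous).sub hh) hφc.continuous
  have c2 : Continuous (separated v fun y => -(α n ^ 2 * Real.sin (α n * y + θ))) :=
    continuous_separated hv.continuous (by fun_prop)
  have I : ∫ z, (ux z * separated w φ z + uy z * separated v ψ z
        - (k : ℂ) ^ 2 * u z * separated v φ z) ∂squareMeasure
      = ∫ z, ux z * separated w φ z ∂squareMeasure + ∫ z, uy z * separated v ψ z ∂squareMeasure
        - ∫ z, (k : ℂ) ^ 2 * u z * separated v φ z ∂squareMeasure := by
    exact integral_add_sub (hH1.2.integrable_mul_two hFx.continuous.memLp_squareMeasure)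
      (hH1.3.integrable_mul_two hFy.continuous.memLp_squareMeasure)
      ((hH1.1.const_mul _).integrable_mul_two hs.memLp_squareMeasure)
  -- The equations for `v` and `φ` give `hφ = -(v''φ + vφ'' + k²vφ)`.
  have J : ∫ z, u z * (h z.1 * φ z.2) ∂squareMeasure
      = -(∫ z, u z * separated (fun x => ((α n ^ 2 - k ^ 2 : ℝ) : ℂ) * v x - h x) φ z
          ∂squareMeasure
        + ∫ z, u z * separated v (fun y => -(α n ^ 2 * Real.sin (α n * y + θ))) z ∂squareMeasure
        - ∫ z, -((k : ℂ) ^ 2 * u z * separated v φ z) ∂squareMeasure) := by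
    have i3 : Integrable (fun z => -((k : ℂ) ^ 2 * u z * separated v φ z)) squareMeasure :=
      ((hH1.1.const_mul _).integrable_mul_two hs.memLp_squareMeasure).neg
    rw [← integral_add_sub (hH1.1.integrable_mul_two c1.memLp_squareMeasure)
      (hH1.1.integrable_mul_two c2.memLp_squareMeasure) i3, ← integral_neg]
    congr 1 with z
    simp only [separated, hφ]
    push_cast
    ring
  have b1 : ∫ x, t .bottom x * separated v ψ (x, 0) ∂sideMeasure = 0 := by
    rcases hB₁ with hb | hb
    · exact integral_mul_eq_zero_of_ae (hdir _ hb)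
    · simp [separated, hψ, hα.bottom_neumann (by rw [hb]; decide)]
  have b3 : ∫ x, t .top x * separated v ψ (x, 1) ∂sideMeasure = 0 := by
    rcases hB₃ with hb | hb
    · exact integral_mul_eq_zero_of_ae (hdir _ hb)
    · have := hα.top_neumann (by rw [hb]; decide) n
      simp [separated, hψ, this]
  have b4 : ∫ y, t .left y * separated w φ (0, y) ∂sideMeasure
      = -(Complex.I * k) * ∫ y, t .left y * separated v φ (0, y) ∂sideMeasure := by
    rw [← integral_const_mul]
    congr 1 with y
    simp only [separated]
    linear_combination (-t .left y * φ y) * hl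
  have b2 : ∫ y, t .right y * separated w φ (1, y) ∂sideMeasure
      = Complex.I * k * if B .right = .impedance then
          ∫ y, t .right y * separated v φ (1, y) ∂sideMeasure else 0 := by
    cases hb : B .right
    · simpa using integral_mul_eq_zero_of_ae (hdir _ hb)
    · rw [hb] at hr
      have : w 1 = 0 := hr
      simp [separated, this]
    · rw [hb] at hr
      have : w 1 = Complex.I * k * v 1 := hr
      rw [if_pos rfl, ← integral_const_mul]
      congr 1 with y
      simp only [separated, this]
      ring
  rw [Side.sum_univ, Side.sum_univ, I] at main
  have n1 : B .bottom ≠ .impedance := by rcases hB₁ with h | h <;> rw [h] <;> decide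
  have n3 : B .top ≠ .impedance := by rcases hB₃ with h | h <;> rw [h] <;> decide
  simp only [n1, n3, hB₄, if_false, if_true, leftData, Pi.zero_apply, zero_mul, integral_zero,
    Side.point, ite_self, zero_add, reduceCtorEq] at main
  have r0 : ∫ y, g y * separated v φ (0, y) ∂sideMeasure
      = ∫ y, g y * (v 0 * φ y) ∂sideMeasure := rfl
  rw [r0] at main
  rw [b1, b3] at P2
  rw [b2, b4] at P1
  rw [J, integral_neg]
  linear_combination main - P1 - P2

theorem IsHelmholtzSolution.ae_eq {u ux uy w wx wy : ℝ × ℝ → ℂ} (hk : 0 < k)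
    (hB₁ : B .bottom = .dirichlet ∨ B .bottom = .neumann)
    (hB₃ : B .top = .dirichlet ∨ B .top = .neumann) (hB₄ : B .left = .impedance)
    (hu : IsHelmholtzSolution k B 0 (leftData g) u ux uy)
    (hw : IsHelmholtzSolution k B 0 (leftData g) w wx wy) : u =ᵐ[squareMeasure] w := by
  obtain ⟨α, θ, hα⟩ := exists_isModeFamily (B .bottom) (B .top)
  have h0 := hα.ae_eq_zero (hu.1.1.sub hw.1.1) fun j n => by
    obtain ⟨V, W, h1, h2, h3, h4, h5, h6⟩ := exists_modeSolution_exp hk (α n ^ 2) (B .right)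
      (Complex.one_add_nat_add_I_sq_ne j (α n ^ 2 - k ^ 2))
    have e1 := hu.integral_mul_separated hB₁ hB₃ hB₄ hα n h1 h2 (by fun_prop) h3 h4 h5 h6
    have e2 := hw.integral_mul_separated hB₁ hB₃ hB₄ hα n h1 h2 (by fun_prop) h3 h4 h5 h6
    have c : Continuous fun z : ℝ × ℝ => Complex.exp ((1 + (j : ℂ) + Complex.I) * z.1)
      * Real.sin (α n * z.2 + θ) := by fun_prop
    simp only [Pi.sub_apply, sub_mul]
    rw [integral_sub (hu.1.1.integrable_mul_two c.memLp_squareMeasure)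
      (hw.1.1.integrable_mul_two c.memLp_squareMeasure), e1, e2, sub_self]
  filter_upwards [h0] with z hz
  simpa [sub_eq_zero] using hz

end

/-! ### Uniqueness of the weak gradient. -/

theorem ae_eq_of_forall_integral_mul_eq {f g : ℝ × ℝ → ℂ} (hf : MemLp f 2 squareMeasure)
    (hg : MemLp g 2 squareMeasure)
    (h : ∀ φ : ℝ × ℝ → ℂ, ContDiff ℝ ∞ φ → HasCompactSupport φ → tsupport φ ⊆ unitSquare →
      ∫ z, f z * φ z ∂squareMeasure = ∫ z, g z * φ z ∂squareMeasure) :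
    f =ᵐ[squareMeasure] g := by
  have hU : IsOpen unitSquare := isOpen_Ioo.prod isOpen_Ioo
  have hi : Integrable (fun z => f z - g z) squareMeasure := (hf.sub hg).integrable (by norm_num)
  have := hU.ae_eq_zero_of_integral_contDiff_smul_eq_zero (μ := squareMeasure)
    (hi.locallyIntegrable.locallyIntegrableOn _) fun φ h1 h2 h3 => by
      have hc : ContDiff ℝ ∞ fun z => (φ z : ℂ) := Complex.ofRealCLM.contDiff.comp h1
      have hs : Function.support (fun z => (φ z : ℂ)) = Function.support φ := by
        ext z; simp
      have := h (fun z => (φ z : ℂ)) hc (h2.comp_left Complex.ofReal_zero) (by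
        rw [tsupport, hs]; exact h3)
      simp only [Complex.real_smul, mul_sub]
      rw [integral_sub]
      · simp only [mul_comm (φ _ : ℂ), this, sub_self]
      · simpa only [mul_comm] using hf.integrable_mul_two hc.continuous.memLp_squareMeasure
      · simpa only [mul_comm] using hg.integrable_mul_two hc.continuous.memLp_squareMeasure
  filter_upwards [this, ae_mem_squareMeasure] with z h1 h2
  exact sub_eq_zero.1 (h1 h2)

/-- Needed because the stability bound concerns every choice of `ux`, `uy`, whereas the estimate is
proved for the constructed solution. -/
theorem MemH1.gradient_ae_eq {u ux uy w wx wy : ℝ × ℝ → ℂ} (hu : MemH1 u ux uy)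
    (hw : MemH1 w wx wy) (h : u =ᵐ[squareMeasure] w) :
    ux =ᵐ[squareMeasure] wx ∧ uy =ᵐ[squareMeasure] wy := by
  have key : ∀ F : ℝ × ℝ → ℂ, ∫ z, u z * F z ∂squareMeasure = ∫ z, w z * F z ∂squareMeasure :=
    fun F => integral_congr_ae (h.mono fun z hz => by simp only [hz])
  constructor
  · refine ae_eq_of_forall_integral_mul_eq hu.2 hw.2 fun φ h1 h2 h3 => ?_
    have e1 := (hu.4 φ h1 h2 h3).1
    rw [key, (hw.4 φ h1 h2 h3).1] at e1
    exact (neg_injective e1).symm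
  · refine ae_eq_of_forall_integral_mul_eq hu.3 hw.3 fun φ h1 h2 h3 => ?_
    have e1 := (hu.4 φ h1 h2 h3).2
    rw [key, (hw.4 φ h1 h2 h3).2] at e1
    exact (neg_injective e1).symm

/-! ### Finite sums of separated functions -/

/-- The finite sum `∑ c n * a n x * b n y`. -/
noncomputable def modeSum (c : ℕ →₀ ℂ) (a : ℕ → ℝ → ℂ) (b : ℕ → ℝ → ℝ) (z : ℝ × ℝ) : ℂ :=
  c.sum fun n x => x * separated (a n) (b n) z

/-- The finite sum `∑ c n * b n y`. -/
noncomputable def sideSum (c : ℕ →₀ ℂ) (b : ℕ → ℝ → ℝ) (y : ℝ) : ℂ :=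
  c.sum fun n x => x * b n y

theorem modeSum_sub (c d : ℕ →₀ ℂ) (a : ℕ → ℝ → ℂ) (b : ℕ → ℝ → ℝ) (z : ℝ × ℝ) :
    modeSum (c - d) a b z = modeSum c a b z - modeSum d a b z :=
  Finsupp.sum_sub_index fun _ _ _ => sub_mul _ _ _

theorem sideSum_sub (c d : ℕ →₀ ℂ) (b : ℕ → ℝ → ℝ) (y : ℝ) :
    sideSum (c - d) b y = sideSum c b y - sideSum d b y :=
  Finsupp.sum_sub_index fun _ _ _ => sub_mul _ _ _

theorem contDiff_modeSum (c : ℕ →₀ ℂ) {a : ℕ → ℝ → ℂ} {b : ℕ → ℝ → ℝ}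
    (ha : ∀ n, ContDiff ℝ ∞ (a n)) (hb : ∀ n, ContDiff ℝ ∞ (b n)) :
    ContDiff ℝ ∞ (modeSum c a b) :=
  ContDiff.sum fun n _ => contDiff_const.mul (contDiff_separated (ha n) (hb n))

theorem continuous_modeSum (c : ℕ →₀ ℂ) {a : ℕ → ℝ → ℂ} {b : ℕ → ℝ → ℝ}
    (ha : ∀ n, Continuous (a n)) (hb : ∀ n, Continuous (b n)) : Continuous (modeSum c a b) :=
  continuous_finsetSum _ fun n _ => continuous_const.mul (continuous_separated (ha n) (hb n))

theorem continuous_sideSum (c : ℕ →₀ ℂ) {b : ℕ → ℝ → ℝ} (hb : ∀ n, Continuous (b n)) :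
    Continuous (sideSum c b) :=
  continuous_finsetSum _ fun n _ =>
    continuous_const.mul (Complex.continuous_ofReal.comp (hb n))

theorem fderiv_modeSum (c : ℕ →₀ ℂ) {a a' : ℕ → ℝ → ℂ} {b b' : ℕ → ℝ → ℝ}
    (ha : ∀ n x, HasDerivAt (a n) (a' n x) x) (hb : ∀ n y, HasDerivAt (b n) (b' n y) y)
    (z : ℝ × ℝ) :
    fderiv ℝ (modeSum c a b) z (1, 0) = modeSum c a' b z ∧
      fderiv ℝ (modeSum c a b) z (0, 1) = modeSum c a b' z := by
  have h : HasFDerivAt (modeSum c a b) (∑ n ∈ c.support, c n • fderiv ℝ (separated (a n) (b n)) z)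
      z := by
    refine HasFDerivAt.fun_sum fun n _ => ?_
    exact (hasFDerivAt_separated (ha n) (hb n) z).differentiableAt.hasFDerivAt.const_mul (c n)
  rw [h.fderiv]
  simp [modeSum, Finsupp.sum, fderiv_separated (ha _) (hb _) z]

theorem norm_sum_mul_ofReal_sq (s : Finset ℕ) (x : ℕ → ℂ) (r : ℕ → ℝ) :
    ‖∑ n ∈ s, x n * r n‖ ^ 2 = ∑ n ∈ s, ∑ m ∈ s, (x n * conj (x m)).re * (r n * r m) := by
  have h : ((‖∑ n ∈ s, x n * r n‖ ^ 2 : ℝ) : ℂ)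
      = ∑ n ∈ s, ∑ m ∈ s, (x n * conj (x m)) * ((r n * r m : ℝ) : ℂ) := by
    push_cast
    rw [← Complex.mul_conj', map_sum, Finset.sum_mul_sum]
    refine Finset.sum_congr rfl fun n _ => Finset.sum_congr rfl fun m _ => ?_
    rw [map_mul, Complex.conj_ofReal]; ring
  have := congrArg Complex.re h
  simpa only [Complex.ofReal_re, Complex.re_sum, Complex.re_mul_ofReal] using this

theorem integral_norm_sum_mul_sq (s : Finset ℕ) (x : ℕ → ℂ) {b : ℕ → ℝ → ℝ}
    (hb : ∀ n, Continuous (b n))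
    (ho : ∀ n m, n ≠ m → ∫ y, b n y * b m y ∂sideMeasure = 0) :
    ∫ y, ‖∑ n ∈ s, x n * b n y‖ ^ 2 ∂sideMeasure
      = ∑ n ∈ s, ‖x n‖ ^ 2 * ∫ y, b n y * b n y ∂sideMeasure := by
  simp only [norm_sum_mul_ofReal_sq]
  rw [integral_finsetSum _ fun n _ => Continuous.integrable_sideMeasure (by fun_prop)]
  refine Finset.sum_congr rfl fun n hn => ?_
  rw [integral_finsetSum _ fun m _ => Continuous.integrable_sideMeasure (by fun_prop)]
  rw [Finset.sum_eq_single n]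
  · rw [integral_const_mul, Complex.mul_conj']
    norm_cast
  · intro m _ hm
    rw [integral_const_mul, ho n m hm.symm, mul_zero]
  · exact fun h => absurd hn h

theorem integral_norm_sideSum_sq (c : ℕ →₀ ℂ) {b : ℕ → ℝ → ℝ}
    (hb : ∀ n, Continuous (b n))
    (ho : ∀ n m, n ≠ m → ∫ y, b n y * b m y ∂sideMeasure = 0) :
    ∫ y, ‖sideSum c b y‖ ^ 2 ∂sideMeasure
      = ∑ n ∈ c.support, ‖c n‖ ^ 2 * ∫ y, b n y * b n y ∂sideMeasure :=
  integral_norm_sum_mul_sq _ _ hb ho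

/-- Parseval on each vertical line, then integration in `x`; the axial factors need no
orthogonality. -/
theorem integral_norm_modeSum_sq (c : ℕ →₀ ℂ) {a : ℕ → ℝ → ℂ} {b : ℕ → ℝ → ℝ}
    (ha : ∀ n, Continuous (a n)) (hb : ∀ n, Continuous (b n))
    (ho : ∀ n m, n ≠ m → ∫ y, b n y * b m y ∂sideMeasure = 0) :
    ∫ z, ‖modeSum c a b z‖ ^ 2 ∂squareMeasure
      = ∑ n ∈ c.support, ‖c n‖ ^ 2 * (∫ x, ‖a n x‖ ^ 2 ∂sideMeasure)
        * ∫ y, b n y * b n y ∂sideMeasure := by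
  have hc := continuous_modeSum c ha hb
  rw [integral_squareMeasure (f := fun z => ‖modeSum c a b z‖ ^ 2) (by fun_prop)]
  have : ∀ x, ∫ y, ‖modeSum c a b (x, y)‖ ^ 2 ∂sideMeasure
      = ∑ n ∈ c.support, ‖c n‖ ^ 2 * ‖a n x‖ ^ 2 * ∫ y, b n y * b n y ∂sideMeasure := by
    intro x
    have := integral_norm_sum_mul_sq c.support (fun n => c n * a n x) hb ho
    simp only [norm_mul, mul_pow] at this
    rw [← this]
    congr 1 with y
    simp only [modeSum, Finsupp.sum, separated, mul_assoc]
  simp only [this]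
  rw [integral_finsetSum _ fun n _ => Continuous.integrable_sideMeasure (by fun_prop)]
  refine Finset.sum_congr rfl fun n _ => ?_
  rw [integral_mul_const, integral_const_mul]

/-! ### The trace inequality -/

/-- The multiplier `m` is `1` on the side and `0` on the opposite one in the applications, so `∫
|F|²` over the side is `±∫ ∂_e(m|F|²)`. The bound then follows from `2|F||∂_e F| ≤ |F|² + |∂_e F|²`.
-/
theorem integral_norm_sq_le_of_parts {F : ℝ × ℝ → ℂ} (hF : ContDiff ℝ ∞ F) {s : Side} {e : ℝ × ℝ}
    {m : ℝ × ℝ → ℝ} (hm : ContDiff ℝ ∞ m) {σ : ℝ} (hσ : |σ| = 1)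
    (hm1 : ∀ z ∈ unitSquare, |m z| ≤ 1) (hm' : ∀ z, |fderiv ℝ m z e| ≤ 1)
    (hparts : ∫ z, fderiv ℝ (fun z => (m z : ℂ) * (F z * conj (F z))) z e ∂squareMeasure
      = σ * ∫ y, F (s.point y) * conj (F (s.point y)) ∂sideMeasure) :
    ∫ y, ‖F (s.point y)‖ ^ 2 ∂sideMeasure
      ≤ 2 * ∫ z, ‖F z‖ ^ 2 ∂squareMeasure + ∫ z, ‖fderiv ℝ F z e‖ ^ 2 ∂squareMeasure := by
  have cF := hF.continuous
  have cF' := hF.continuous_fderiv_dir e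
  have hmc : ContDiff ℝ ∞ fun z => (m z : ℂ) := Complex.ofRealCLM.contDiff.comp hm
  have hmd : ∀ z, fderiv ℝ (fun z => (m z : ℂ)) z e = (fderiv ℝ m z e : ℝ) := fun z => by
    have h := (Complex.ofRealCLM.hasFDerivAt (x := m z)).comp z
      (hm.differentiable (by simp) z).hasFDerivAt
    rw [show (fun z => (m z : ℂ)) = Complex.ofRealCLM ∘ m from rfl, h.fderiv]
    simp
  have h1 : ∫ y, F (s.point y) * conj (F (s.point y)) ∂sideMeasure
      = ((∫ y, ‖F (s.point y)‖ ^ 2 ∂sideMeasure : ℝ) : ℂ) := by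
    rw [← integral_complex_ofReal]
    congr 1 with y
    rw [Complex.mul_conj']; norm_cast
  have h2 : ∫ y, ‖F (s.point y)‖ ^ 2 ∂sideMeasure
      = ‖∫ z, fderiv ℝ (fun z => (m z : ℂ) * (F z * conj (F z))) z e ∂squareMeasure‖ := by
    rw [hparts, h1, norm_mul, Complex.norm_real, Complex.norm_real, Real.norm_eq_abs, hσ, one_mul,
      Real.norm_eq_abs, abs_of_nonneg (integral_nonneg fun _ => by positivity)]
  rw [h2, ← integral_const_mul, ← integral_add
    (Continuous.integrable_squareMeasure (by fun_prop))
    (Continuous.integrable_squareMeasure (by fun_prop))]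
  refine norm_integral_le_of_norm_le (Continuous.integrable_squareMeasure (by fun_prop)) ?_
  filter_upwards [ae_mem_squareMeasure] with z hz
  rw [fderiv_mul_dir hmc (hF.mul hF.complex_conj), fderiv_mul_dir hF hF.complex_conj, hmd,
    fderiv_complex_conj hF]
  have k1 := hm1 z hz
  have k2 := hm' z
  set a := F z
  set b := fderiv ℝ F z e
  calc ‖a * conj a * ((fderiv ℝ m z e : ℝ) : ℂ) + (conj a * b + conj b * a) * (m z : ℂ)‖
      ≤ ‖a‖ * ‖a‖ * |fderiv ℝ m z e| + (‖a‖ * ‖b‖ + ‖b‖ * ‖a‖) * |m z| := by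
        refine (norm_add_le _ _).trans ?_
        rw [norm_mul, norm_mul, norm_mul, Complex.norm_real, Complex.norm_real, RCLike.norm_conj,
          Real.norm_eq_abs, Real.norm_eq_abs]
        gcongr
        refine (norm_add_le _ _).trans ?_
        rw [norm_mul, norm_mul, RCLike.norm_conj, RCLike.norm_conj]
    _ ≤ ‖a‖ * ‖a‖ * 1 + (‖a‖ * ‖b‖ + ‖b‖ * ‖a‖) * 1 := by gcongr
    _ ≤ 2 * ‖a‖ ^ 2 + ‖b‖ ^ 2 := by nlinarith [sq_nonneg (‖a‖ - ‖b‖)]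

theorem integral_norm_trace_sq_le {F : ℝ × ℝ → ℂ} (hF : ContDiff ℝ ∞ F) (s : Side) :
    ∫ y, ‖F (s.point y)‖ ^ 2 ∂sideMeasure
      ≤ 2 * ∫ z, ‖F z‖ ^ 2 ∂squareMeasure + ∫ z, ‖fderiv ℝ F z (1, 0)‖ ^ 2 ∂squareMeasure
        + ∫ z, ‖fderiv ℝ F z (0, 1)‖ ^ 2 ∂squareMeasure := by
  have hx : 0 ≤ ∫ z, ‖fderiv ℝ F z (1, 0)‖ ^ 2 ∂squareMeasure :=
    integral_nonneg fun _ => by positivity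
  have hy : 0 ≤ ∫ z, ‖fderiv ℝ F z (0, 1)‖ ^ 2 ∂squareMeasure :=
    integral_nonneg fun _ => by positivity
  have hG := hF.mul hF.complex_conj
  have h1 : ContDiff ℝ ∞ (Prod.fst : ℝ × ℝ → ℝ) := contDiff_fst
  have h2 : ContDiff ℝ ∞ (Prod.snd : ℝ × ℝ → ℝ) := contDiff_snd
  have d1 : ∀ z e, fderiv ℝ (fun z : ℝ × ℝ => z.1) z e = e.1 := fun z e => by simp [fderiv_fst]
  have d2 : ∀ z e, fderiv ℝ (fun z : ℝ × ℝ => z.2) z e = e.2 := fun z e => by simp [fderiv_snd]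
  have d3 : ∀ z e, fderiv ℝ (fun z : ℝ × ℝ => 1 - z.1) z e = -e.1 := fun z e => by
    rw [fderiv_const_sub]; simp [d1]
  have d4 : ∀ z e, fderiv ℝ (fun z : ℝ × ℝ => 1 - z.2) z e = -e.2 := fun z e => by
    rw [fderiv_const_sub]; simp [d2]
  have cast : ∀ {m : ℝ × ℝ → ℝ}, ContDiff ℝ ∞ m →
      ContDiff ℝ ∞ fun z => (m z : ℂ) * (F z * conj (F z)) := fun hm =>
    (Complex.ofRealCLM.contDiff.comp hm).mul hG
  cases s
  · have := integral_norm_sq_le_of_parts hF (s := .bottom) (e := (0, 1))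
      (m := fun z => 1 - z.2) (contDiff_const.sub h2) (σ := -1) (by simp)
      (fun z hz => abs_le.2 ⟨by linarith [hz.2.2], by linarith [hz.2.1]⟩) (by simp [d4])
      (by rw [integral_fderiv_snd (cast (contDiff_const.sub h2))]; simp [Side.point])
    linarith
  · have := integral_norm_sq_le_of_parts hF (s := .right) (e := (1, 0))
      (m := fun z => z.1) h1 (σ := 1) (by simp)
      (fun z hz => abs_le.2 ⟨by linarith [hz.1.1], by linarith [hz.1.2]⟩) (by simp [d1])
      (by rw [integral_fderiv_fst (cast h1)]; simp [Side.point])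
    linarith
  · have := integral_norm_sq_le_of_parts hF (s := .top) (e := (0, 1))
      (m := fun z => z.2) h2 (σ := 1) (by simp)
      (fun z hz => abs_le.2 ⟨by linarith [hz.2.1], by linarith [hz.2.2]⟩) (by simp [d2])
      (by rw [integral_fderiv_snd (cast h2)]; simp [Side.point])
    linarith
  · have := integral_norm_sq_le_of_parts hF (s := .left) (e := (1, 0))
      (m := fun z => 1 - z.1) (contDiff_const.sub h1) (σ := -1) (by simp)
      (fun z hz => abs_le.2 ⟨by linarith [hz.1.2], by linarith [hz.1.1]⟩) (by simp [d3])
      (by rw [integral_fderiv_fst (cast (contDiff_const.sub h1))]; simp [Side.point])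
    linarith

/-! ### Density of the transverse modes and convergence of mode sums -/

theorem IsModeFamily.exists_sideSum_approx {b t : BoundaryOperator} {α : ℕ → ℝ} {θ : ℝ}
    (hα : IsModeFamily b t α θ) {g : ℝ → ℂ} (hg : MemLp g 2 sideMeasure) {ε : ℝ} (hε : 0 < ε) :
    ∃ c : ℕ →₀ ℂ, √(∫ y, ‖sideSum c (fun n y => Real.sin (α n * y + θ)) y - g y‖ ^ 2
      ∂sideMeasure) < ε := by
  set b : ℕ → ℝ → ℝ := fun n y => Real.sin (α n * y + θ) with hb
  have cb : ∀ n, Continuous (b n) := fun n => by fun_prop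
  have hS : ∀ c, MemLp (sideSum c b) 2 sideMeasure := fun c =>
    (continuous_sideSum c cb).memLp_sideMeasure
  have hbc : ∀ n, MemLp (fun y => (b n y : ℂ)) 2 sideMeasure := fun n =>
    (Complex.continuous_ofReal.comp (cb n)).memLp_sideMeasure
  let e : ℕ → Lp ℂ 2 sideMeasure := fun n => (hbc n).toLp
  have hsum : ∀ c : ℕ →₀ ℂ, (hS c).toLp = c.sum fun n x => x • e n := by
    intro c
    induction c using Finsupp.induction_linear with
    | zero =>
      simp only [Finsupp.sum_zero_index]
      rw [← MemLp.toLp_zero (MemLp.zero (p := 2) (μ := sideMeasure) (ε := ℂ))]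
      refine MemLp.toLp_congr _ _ (Eventually.of_forall fun y => ?_)
      simp [sideSum]
    | add c d h1 h2 =>
      rw [Finsupp.sum_add_index' (by simp) (by simp [add_smul]), ← h1, ← h2, ← MemLp.toLp_add]
      refine MemLp.toLp_congr _ _ (Eventually.of_forall fun y => ?_)
      exact Finsupp.sum_add_index' (by simp) (by simp [add_mul])
    | single n x =>
      rw [Finsupp.sum_single_index (by simp), ← MemLp.toLp_const_smul]
      refine MemLp.toLp_congr _ _ (Eventually.of_forall fun y => ?_)
      simp [sideSum]
  -- A function of `y` orthogonal to all modes, regarded as a function on the square, satisfies the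
  -- hypothesis of the two-dimensional totality lemma by Fubini.
  have htop : (Submodule.span ℂ (range e)).topologicalClosure = ⊤ := by
    rw [Submodule.topologicalClosure_eq_top_iff, Submodule.eq_bot_iff]
    intro f hf
    have hf0 : ∀ n, ∫ y, f y * b n y ∂sideMeasure = 0 := by
      intro n
      have := (Submodule.mem_orthogonal _ _).1 hf (e n) (Submodule.subset_span ⟨n, rfl⟩)
      rw [L2.inner_def] at this
      rw [← this]
      refine integral_congr_ae ((hbc n).coeFn_toLp.mono fun y hy => ?_)
      simp only [e, hy]
      simp
    have hf2 : MemLp (fun z : ℝ × ℝ => f z.2) 2 squareMeasure := by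
      rw [squareMeasure_eq_prod]; exact (Lp.memLp f).comp_snd _
    have h0 := hα.ae_eq_zero hf2 fun j n => by
      have e1 : ∀ z : ℝ × ℝ, f z.2 * (Complex.exp ((1 + (j : ℂ) + Complex.I) * z.1)
          * Real.sin (α n * z.2 + θ)) = Complex.exp ((1 + (j : ℂ) + Complex.I) * z.1)
            * (f z.2 * b n z.2) := fun z => by simp only [hb]; ring
      simp only [e1, squareMeasure_eq_prod]
      rw [integral_prod_mul (fun x : ℝ => Complex.exp ((1 + (j : ℂ) + Complex.I) * x))
        (fun y => f y * b n y), hf0, mul_zero]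
    rw [squareMeasure_eq_prod] at h0
    obtain ⟨x, hx⟩ := (Measure.ae_ae_of_ae_prod h0).exists
    exact (Lp.eq_zero_iff_ae_eq_zero).2 hx
  have hmem : hg.toLp ∈ (Submodule.span ℂ (range e)).topologicalClosure := by
    rw [htop]; trivial
  obtain ⟨x, hx, hxd⟩ := Metric.mem_closure_iff.1 hmem ε hε
  obtain ⟨c, rfl⟩ := Finsupp.mem_span_range_iff_exists_finsupp.1 hx
  refine ⟨c, ?_⟩
  rw [← hsum, dist_comm, dist_eq_norm, ← MemLp.toLp_sub, Lp.norm_toLp,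
    eLpNorm_two_eq_ofReal_sqrt ((hS c).sub hg), ENNReal.toReal_ofReal (Real.sqrt_nonneg _)] at hxd
  exact hxd

/-- An additive map bounded by the data carries a rapidly converging sequence of data to a Cauchy
sequence. It is applied to the mode sum, its two derivatives and its four boundary restrictions. -/
theorem exists_limit_of_bounded {β γ : Type*} [MeasurableSpace β] [MeasurableSpace γ]
    {μ : Measure β} {ν : Measure γ} {T : (ℕ →₀ ℂ) → β → ℂ} {S : (ℕ →₀ ℂ) → γ → ℂ}
    (hT : ∀ c, MemLp (T c) 2 μ) (hS : ∀ c, MemLp (S c) 2 ν)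
    (hTs : ∀ c d x, T (c - d) x = T c x - T d x) (hSs : ∀ c d x, S (c - d) x = S c x - S d x)
    {K : ℝ} (hK : ∀ c, ∫ x, ‖T c x‖ ^ 2 ∂μ ≤ K * ∫ x, ‖S c x‖ ^ 2 ∂ν) {g : γ → ℂ}
    (hg : MemLp g 2 ν) {c : ℕ → ℕ →₀ ℂ}
    (hc : ∀ j, √(∫ x, ‖S (c j) x - g x‖ ^ 2 ∂ν) ≤ (1 / 2) ^ j) :
    ∃ f, MemLp f 2 μ ∧ Tendsto (fun j => eLpNorm (fun x => T (c j) x - f x) 2 μ) atTop (𝓝 0) := by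
  have hsm : Summable fun j : ℕ => (√K + 1) * 3 * (1 / 2 : ℝ) ^ j :=
    (summable_geometric_of_lt_one (by norm_num) (by norm_num)).mul_left _
  refine Lp.cauchy_complete_eLpNorm (by norm_num) (fun j => hT (c j))
    (B := fun j => ENNReal.ofReal ((√K + 1) * 3 * (1 / 2) ^ j)) hsm.tsum_ofReal_ne_top ?_
  intro N n m hn hm
  have e1 : T (c n) - T (c m) = T (c n - c m) := by
    ext x; rw [hTs]; rfl
  -- The differences are at most `2√K (1/2)^N`; enlarging this to `3(√K + 1)(1/2)^N` yields the
  -- strict inequality even when `√K = 0`.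
  rw [e1, eLpNorm_two_eq_ofReal_sqrt (hT _), ENNReal.ofReal_lt_ofReal_iff (by positivity)]
  have h1 : √(∫ x, ‖S (c n - c m) x‖ ^ 2 ∂ν) ≤ 2 * (1 / 2) ^ N := by
    have t1 := sqrt_integral_norm_sq_le_add ((hS (c n)).sub (hS (c m))) ((hS (c n)).sub hg)
    simp only [Pi.sub_apply, sub_sub_sub_cancel_left, norm_sub_rev (g _)] at t1
    simp only [hSs]
    have p : ∀ i, N ≤ i → (1 / 2 : ℝ) ^ i ≤ (1 / 2) ^ N := fun i hi =>
      pow_le_pow_of_le_one (by norm_num) (by norm_num) hi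
    linarith [hc n, hc m, p n hn, p m hm]
  have hpos : (0 : ℝ) < (1 / 2) ^ N := by positivity
  have hK0 := Real.sqrt_nonneg K
  calc √(∫ x, ‖T (c n - c m) x‖ ^ 2 ∂μ) ≤ √(K * ∫ x, ‖S (c n - c m) x‖ ^ 2 ∂ν) :=
        Real.sqrt_le_sqrt (hK _)
    _ = √K * √(∫ x, ‖S (c n - c m) x‖ ^ 2 ∂ν) :=
        Real.sqrt_mul' _ (integral_nonneg fun _ => by positivity)
    _ ≤ √K * (2 * (1 / 2) ^ N) := by gcongr
    _ < (√K + 1) * 3 * (1 / 2) ^ N := by nlinarith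

/-! ### Existence and stability -/

section Conj

variable {v vx vy : ℝ × ℝ → ℂ} {τ : Side → ℝ → ℂ} {F : ℝ × ℝ → ℂ}

theorem integral_by_parts_conj_fst (hv : MemH1 v vx vy) (hτ : ∀ s, HasTrace v vx vy s (τ s))
    (hF : ContDiff ℝ ∞ F) :
    ∫ z, fderiv ℝ F z (1, 0) * conj (v z) ∂squareMeasure + ∫ z, F z * conj (vx z) ∂squareMeasure
      = ∫ y, F (1, y) * conj (τ .right y) ∂sideMeasure
        - ∫ y, F (0, y) * conj (τ .left y) ∂sideMeasure := by
  have := congrArg conj (integral_by_parts_fst hv hτ hF.complex_conj)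
  simp only [map_add, map_sub, ← integral_conj, map_mul, fderiv_complex_conj hF,
    Complex.conj_conj] at this
  simpa only [mul_comm] using this

theorem integral_by_parts_conj_snd (hv : MemH1 v vx vy) (hτ : ∀ s, HasTrace v vx vy s (τ s))
    (hF : ContDiff ℝ ∞ F) :
    ∫ z, fderiv ℝ F z (0, 1) * conj (v z) ∂squareMeasure + ∫ z, F z * conj (vy z) ∂squareMeasure
      = ∫ x, F (x, 1) * conj (τ .top x) ∂sideMeasure
        - ∫ x, F (x, 0) * conj (τ .bottom x) ∂sideMeasure := by
  have := congrArg conj (integral_by_parts_snd hv hτ hF.complex_conj)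
  simp only [map_add, map_sub, ← integral_conj, map_mul, fderiv_complex_conj hF,
    Complex.conj_conj] at this
  simpa only [mul_comm] using this

end Conj

/-- `sin (α n * y + θ)`. -/
noncomputable def transverse (α : ℕ → ℝ) (θ : ℝ) (n : ℕ) (y : ℝ) : ℝ := Real.sin (α n * y + θ)

/-- The derivative of `sin (α n * y + θ)`. -/
noncomputable def transverseDeriv (α : ℕ → ℝ) (θ : ℝ) (n : ℕ) (y : ℝ) : ℝ :=
  α n * Real.cos (α n * y + θ)

theorem contDiff_transverse (α : ℕ → ℝ) (θ : ℝ) (n : ℕ) : ContDiff ℝ ∞ (transverse α θ n) :=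
  contDiff_sin_mode _ _

theorem contDiff_transverseDeriv (α : ℕ → ℝ) (θ : ℝ) (n : ℕ) :
    ContDiff ℝ ∞ (transverseDeriv α θ n) :=
  contDiff_cos_mode _ _

theorem hasDerivAt_transverse (α : ℕ → ℝ) (θ : ℝ) (n : ℕ) (y : ℝ) :
    HasDerivAt (transverse α θ n) (transverseDeriv α θ n y) y :=
  hasDerivAt_sin_mode _ _ _

theorem hasDerivAt_transverseDeriv (α : ℕ → ℝ) (θ : ℝ) (n : ℕ) (y : ℝ) :
    HasDerivAt (transverseDeriv α θ n) (-(α n ^ 2 * transverse α θ n y)) y :=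
  hasDerivAt_cos_mode _ _ _

/-- `v n`, with derivative `w n`, solves the separated equation for the `n`-th mode with the
boundary condition `β` at `x = 1` and unit impedance data at `x = 0`. -/
structure IsAxialFamily (k : ℝ) (β : BoundaryOperator) (α : ℕ → ℝ) (v w : ℕ → ℝ → ℂ) : Prop where
  solution : ∀ n, IsModeSolution (α n ^ 2 - k ^ 2) (v n) (w n)
  right : ∀ n, β.rightCondition k (v n 1) (w n 1)
  left : ∀ n, -w n 0 - Complex.I * k * v n 0 = 1

section

variable {k : ℝ} {B : Side → BoundaryOperator} {α : ℕ → ℝ} {θ : ℝ} {a a' : ℕ → ℝ → ℂ}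

/-- Orthogonality reduces the bound to each mode, where `∫ |φ_n'|² = l ∫ |φ_n|²` produces exactly
the weight `l + k²` of the one-dimensional energy. -/
theorem modeSum_stability (hk : 0 < k) (hα : IsModeFamily (B .bottom) (B .top) α θ)
    (ha : IsAxialFamily k (B .right) α a a') (c : ℕ →₀ ℂ) :
    ∫ z, ‖modeSum c a' (transverse α θ) z‖ ^ 2 ∂squareMeasure
        + ∫ z, ‖modeSum c a (transverseDeriv α θ) z‖ ^ 2 ∂squareMeasure
        + k ^ 2 * ∫ z, ‖modeSum c a (transverse α θ) z‖ ^ 2 ∂squareMeasure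
      ≤ 6 * max k 1 ^ 2 * ∫ y, ‖sideSum c (transverse α θ) y‖ ^ 2 ∂sideMeasure := by
  have ca : ∀ n, Continuous (a n) := fun n => (ha.1 n).1.continuous
  have ca' : ∀ n, Continuous (a' n) := fun n => (ha.1 n).2.continuous
  have ct : ∀ n, Continuous (transverse α θ n) := fun n => (contDiff_transverse α θ n).continuous
  have ct' : ∀ n, Continuous (transverseDeriv α θ n) := fun n =>
    (contDiff_transverseDeriv α θ n).continuous
  have ho : ∀ n m, n ≠ m → ∫ y, transverse α θ n y * transverse α θ m y ∂sideMeasure = 0 :=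
    fun n m h => hα.orthogonal h
  have ho' : ∀ n m, n ≠ m →
      ∫ y, transverseDeriv α θ n y * transverseDeriv α θ m y ∂sideMeasure = 0 :=
    fun n m h => hα.orthogonal_deriv h
  have hn : ∀ n, ∫ y, transverseDeriv α θ n y * transverseDeriv α θ n y ∂sideMeasure
      = α n ^ 2 * ∫ y, transverse α θ n y * transverse α θ n y ∂sideMeasure :=
    fun n => hα.integral_deriv_mul_deriv n n
  rw [integral_norm_modeSum_sq c ca' ct ho, integral_norm_modeSum_sq c ca ct' ho',
    integral_norm_modeSum_sq c ca ct ho, integral_norm_sideSum_sq c ct ho, Finset.mul_sum,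
    Finset.mul_sum, ← Finset.sum_add_distrib, ← Finset.sum_add_distrib]
  refine Finset.sum_le_sum fun n _ => ?_
  have h1 := (ha.1 n).integral_energy_le hk (hα.gap n) (ha.2 n)
  rw [ha.3 n, integral_add (Continuous.integrable_sideMeasure (by fun_prop))
    (Continuous.integrable_sideMeasure (by fun_prop)), integral_const_mul, norm_one, one_pow,
    mul_one] at h1
  rw [hn]
  set N := ∫ y, transverse α θ n y * transverse α θ n y ∂sideMeasure with hN
  have hN0 : 0 ≤ ‖c n‖ ^ 2 * N := mul_nonneg (by positivity)
    (integral_nonneg fun y => mul_self_nonneg _)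
  have h2 := mul_le_mul_of_nonneg_left h1 hN0
  linarith

theorem modeSum_boundary (hα : IsModeFamily (B .bottom) (B .top) α θ)
    (ha : IsAxialFamily k (B .right) α a a') (c : ℕ →₀ ℂ) (y : ℝ) :
    modeSum c a' (transverse α θ) (0, y)
        = -(sideSum c (transverse α θ) y + Complex.I * k * modeSum c a (transverse α θ) (0, y)) ∧
      (B .right).rightCondition k (modeSum c a (transverse α θ) (1, y))
        (modeSum c a' (transverse α θ) (1, y)) ∧
      (B .bottom = .dirichlet → modeSum c a (transverse α θ) (y, 0) = 0) ∧
      (B .bottom ≠ .dirichlet → modeSum c a (transverseDeriv α θ) (y, 0) = 0) ∧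
      (B .top = .dirichlet → modeSum c a (transverse α θ) (y, 1) = 0) ∧
      (B .top ≠ .dirichlet → modeSum c a (transverseDeriv α θ) (y, 1) = 0) := by
  refine ⟨?_, ?_, fun h => ?_, fun h => ?_, fun h => ?_, fun h => ?_⟩
  · simp only [modeSum, sideSum, Finsupp.sum, separated, Finset.mul_sum]
    rw [← Finset.sum_add_distrib, ← Finset.sum_neg_distrib]
    refine Finset.sum_congr rfl fun n _ => ?_
    linear_combination (-c n * transverse α θ n y) * ha.left n
  · have hr := ha.right
    cases hb : B .right
    · rw [hb] at hr
      have : ∀ n, a n 1 = 0 := hr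
      simp [BoundaryOperator.rightCondition, modeSum, separated, this]
    · rw [hb] at hr
      have : ∀ n, a' n 1 = 0 := hr
      simp [BoundaryOperator.rightCondition, modeSum, separated, this]
    · rw [hb] at hr
      have : ∀ n, a' n 1 = Complex.I * k * a n 1 := hr
      simp only [BoundaryOperator.rightCondition, modeSum, separated, this, Finsupp.sum,
        Finset.mul_sum]
      exact Finset.sum_congr rfl fun n _ => by ring
  · simp [modeSum, separated, transverse, hα.bottom_dirichlet h]
  · have := hα.bottom_neumann h
    have e : ∀ n, transverseDeriv α θ n 0 = 0 := fun n => by simpa [transverseDeriv] using this n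
    simp [modeSum, separated, e]
  · simp [modeSum, separated, transverse, hα.top_dirichlet h]
  · have := hα.top_neumann h
    have e : ∀ n, transverseDeriv α θ n 1 = 0 := fun n => by simpa [transverseDeriv] using this n
    simp [modeSum, separated, e]

/-- A mode sum is a classical solution with data `sideSum c`. Green's formula against an arbitrary
`H¹` function turns this into the weak identity, ready for the limit. -/
theorem modeSum_weak (hB₁ : B .bottom = .dirichlet ∨ B .bottom = .neumann)
    (hB₃ : B .top = .dirichlet ∨ B .top = .neumann)
    (hα : IsModeFamily (B .bottom) (B .top) α θ)
    (ha : IsAxialFamily k (B .right) α a a') (c : ℕ →₀ ℂ) {v vx vy : ℝ × ℝ → ℂ}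
    {τ : Side → ℝ → ℂ} (hv : MemH1 v vx vy) (hτ : ∀ s, HasTrace v vx vy s (τ s))
    (hd : ∀ s, B s = .dirichlet → τ s =ᵐ[sideMeasure] 0) :
    ∫ z, modeSum c a' (transverse α θ) z * conj (vx z) ∂squareMeasure
        + ∫ z, modeSum c a (transverseDeriv α θ) z * conj (vy z) ∂squareMeasure
        - k ^ 2 * ∫ z, modeSum c a (transverse α θ) z * conj (v z) ∂squareMeasure
      = Complex.I * k * ((if B .right = .impedance then
            ∫ y, modeSum c a (transverse α θ) (Side.point .right y) * conj (τ .right y) ∂sideMeasure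
            else 0)
          + ∫ y, modeSum c a (transverse α θ) (Side.point .left y) * conj (τ .left y) ∂sideMeasure)
        + ∫ y, sideSum c (transverse α θ) y * conj (τ .left y) ∂sideMeasure := by
  have hU : ContDiff ℝ ∞ (modeSum c a (transverse α θ)) :=
    contDiff_modeSum c (fun n => (ha.1 n).1) (contDiff_transverse α θ)
  have hUx : ContDiff ℝ ∞ (modeSum c a' (transverse α θ)) :=
    contDiff_modeSum c (fun n => (ha.1 n).2) (contDiff_transverse α θ)
  have hUy : ContDiff ℝ ∞ (modeSum c a (transverseDeriv α θ)) :=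
    contDiff_modeSum c (fun n => (ha.1 n).1) (contDiff_transverseDeriv α θ)
  have P1 := integral_by_parts_conj_fst hv hτ hUx
  have P2 := integral_by_parts_conj_snd hv hτ hUy
  have hbd := modeSum_boundary hα ha c
  have z0 : ∀ {t w : ℝ → ℂ}, t =ᵐ[sideMeasure] 0 → ∫ y, w y * conj (t y) ∂sideMeasure = 0 := by
    intro t w h
    rw [integral_congr_ae (g := fun _ => 0) (h.mono fun y hy => by simp [hy]), integral_zero]
  have b1 : ∫ x, modeSum c a (transverseDeriv α θ) (x, 0) * conj (τ .bottom x) ∂sideMeasure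
      = 0 := by
    rcases hB₁ with hb | hb
    · exact z0 (hd _ hb)
    · simp [fun y => (hbd y).2.2.2.1 (by rw [hb]; decide)]
  have b3 : ∫ x, modeSum c a (transverseDeriv α θ) (x, 1) * conj (τ .top x) ∂sideMeasure = 0 := by
    rcases hB₃ with hb | hb
    · exact z0 (hd _ hb)
    · simp [fun y => (hbd y).2.2.2.2.2 (by rw [hb]; decide)]
  have b2 : ∫ y, modeSum c a' (transverse α θ) (1, y) * conj (τ .right y) ∂sideMeasure
      = Complex.I * k * if B .right = .impedance then
        ∫ y, modeSum c a (transverse α θ) (1, y) * conj (τ .right y) ∂sideMeasure else 0 := by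
    have hr := fun y => (hbd y).2.1
    cases hb : B .right
    · simpa using z0 (hd _ hb)
    · rw [hb] at hr
      have : ∀ y, modeSum c a' (transverse α θ) (1, y) = 0 := hr
      simp [this]
    · rw [hb] at hr
      have : ∀ y, modeSum c a' (transverse α θ) (1, y)
        = Complex.I * k * modeSum c a (transverse α θ) (1, y) := hr
      rw [if_pos rfl, ← integral_const_mul]
      simp only [this, mul_assoc]
  have hl := (hτ .left).1
  have cS : Continuous (sideSum c (transverse α θ)) :=
    continuous_sideSum c fun n => (contDiff_transverse α θ n).continuous
  have cU0 : Continuous fun y => modeSum c a (transverse α θ) (0, y) :=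
    hU.continuous.comp (by fun_prop)
  have b4 : ∫ y, modeSum c a' (transverse α θ) (0, y) * conj (τ .left y) ∂sideMeasure
      = -(∫ y, sideSum c (transverse α θ) y * conj (τ .left y) ∂sideMeasure
        + Complex.I * k
          * ∫ y, modeSum c a (transverse α θ) (0, y) * conj (τ .left y) ∂sideMeasure) := by
    rw [← integral_const_mul, ← integral_add (cS.memLp_sideMeasure.integrable_mul_two hl.conj)
      ((cU0.memLp_sideMeasure.integrable_mul_two hl.conj).const_mul _), ← integral_neg]
    congr 1 with y
    rw [(hbd y).1]; ring
  have pde : ∫ z, fderiv ℝ (modeSum c a' (transverse α θ)) z (1, 0) * conj (v z) ∂squareMeasure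
      + ∫ z, fderiv ℝ (modeSum c a (transverseDeriv α θ)) z (0, 1) * conj (v z) ∂squareMeasure
      = -(k ^ 2 * ∫ z, modeSum c a (transverse α θ) z * conj (v z) ∂squareMeasure) := by
    rw [← integral_add
      ((hUx.continuous_fderiv_dir _).memLp_squareMeasure.integrable_mul_two hv.1.conj)
      ((hUy.continuous_fderiv_dir _).memLp_squareMeasure.integrable_mul_two hv.1.conj),
      ← integral_const_mul, ← integral_neg]
    congr 1 with z
    rw [(fderiv_modeSum c (fun n => (ha.1 n).4) (hasDerivAt_transverse α θ) z).1,
      (fderiv_modeSum c (fun n => (ha.1 n).3) (hasDerivAt_transverseDeriv α θ) z).2,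
      ← add_mul, ← mul_assoc, ← neg_mul]
    congr 1
    simp only [modeSum, Finsupp.sum, Finset.mul_sum]
    rw [← Finset.sum_add_distrib, ← Finset.sum_neg_distrib]
    refine Finset.sum_congr rfl fun n _ => ?_
    simp only [separated, transverse]
    push_cast; ring
  rw [b1, b3] at P2
  rw [b2, b4] at P1
  simp only [Side.point]
  linear_combination P1 + P2 - pde

end

theorem exists_helmholtzSolution_le {k : ℝ} (hk : 0 < k) {B : Side → BoundaryOperator}
    (hB₁ : B .bottom = .dirichlet ∨ B .bottom = .neumann)
    (hB₃ : B .top = .dirichlet ∨ B .top = .neumann) (hB₄ : B .left = .impedance)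
    {g : ℝ → ℂ} (hg : MemLp g 2 sideMeasure) :
    ∃ u ux uy : ℝ × ℝ → ℂ, IsHelmholtzSolution k B 0 (leftData g) u ux uy ∧
      ∫ z, ‖ux z‖ ^ 2 ∂squareMeasure + ∫ z, ‖uy z‖ ^ 2 ∂squareMeasure
        + k ^ 2 * ∫ z, ‖u z‖ ^ 2 ∂squareMeasure
      ≤ 6 * max k 1 ^ 2 * ∫ y, ‖g y‖ ^ 2 ∂sideMeasure := by
  obtain ⟨α, θ, hα⟩ := exists_isModeFamily (B .bottom) (B .top)
  choose a a' h1 h2 h3 using fun n => exists_normalized_isModeSolution hk (α n ^ 2) (B .right)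
  have ha : IsAxialFamily k (B .right) α a a' := ⟨h1, h2, h3⟩
  choose c hc using fun j : ℕ => hα.exists_sideSum_approx hg
    (by positivity : (0 : ℝ) < (1 / 2) ^ j)
  let S : (ℕ →₀ ℂ) → ℝ → ℂ := fun c => sideSum c (transverse α θ)
  let U : (ℕ →₀ ℂ) → ℝ × ℝ → ℂ := fun c => modeSum c a (transverse α θ)
  let Ux : (ℕ →₀ ℂ) → ℝ × ℝ → ℂ := fun c => modeSum c a' (transverse α θ)
  let Uy : (ℕ →₀ ℂ) → ℝ × ℝ → ℂ := fun c => modeSum c a (transverseDeriv α θ)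
  have hU : ∀ c, ContDiff ℝ ∞ (U c) := fun c =>
    contDiff_modeSum c (fun n => (ha.1 n).1) (contDiff_transverse α θ)
  have hUx : ∀ c, ContDiff ℝ ∞ (Ux c) := fun c =>
    contDiff_modeSum c (fun n => (ha.1 n).2) (contDiff_transverse α θ)
  have hUy : ∀ c, ContDiff ℝ ∞ (Uy c) := fun c =>
    contDiff_modeSum c (fun n => (ha.1 n).1) (contDiff_transverseDeriv α θ)
  have dU : ∀ c z, fderiv ℝ (U c) z (1, 0) = Ux c z ∧ fderiv ℝ (U c) z (0, 1) = Uy c z :=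
    fun c z => fderiv_modeSum c (fun n => (ha.1 n).3) (hasDerivAt_transverse α θ) z
  have mS : ∀ c, MemLp (S c) 2 sideMeasure := fun c =>
    (continuous_sideSum c fun n => (contDiff_transverse α θ n).continuous).memLp_sideMeasure
  have mU : ∀ c, MemLp (U c) 2 squareMeasure := fun c => (hU c).continuous.memLp_squareMeasure
  have mUx : ∀ c, MemLp (Ux c) 2 squareMeasure := fun c => (hUx c).continuous.memLp_squareMeasure
  have mUy : ∀ c, MemLp (Uy c) 2 squareMeasure := fun c => (hUy c).continuous.memLp_squareMeasure
  have mUs : ∀ (s : Side) c, MemLp (fun y => U c (s.point y)) 2 sideMeasure := fun s c =>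
    ((hU c).continuous.comp s.continuous_point).memLp_sideMeasure
  set D := 6 * max k 1 ^ 2 with hD
  have hstab : ∀ c, ∫ z, ‖Ux c z‖ ^ 2 ∂squareMeasure + ∫ z, ‖Uy c z‖ ^ 2 ∂squareMeasure
      + k ^ 2 * ∫ z, ‖U c z‖ ^ 2 ∂squareMeasure ≤ D * ∫ y, ‖S c y‖ ^ 2 ∂sideMeasure := fun c =>
    modeSum_stability hk hα ha c
  have pos : ∀ {β : Type} [MeasurableSpace β] (μ : Measure β) (f : β → ℂ),
      0 ≤ ∫ z, ‖f z‖ ^ 2 ∂μ := fun μ f => integral_nonneg fun _ => by positivity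
  have hk2 : 0 < k ^ 2 := by positivity
  have bU : ∀ c, ∫ z, ‖U c z‖ ^ 2 ∂squareMeasure ≤ D / k ^ 2 * ∫ y, ‖S c y‖ ^ 2 ∂sideMeasure := by
    intro c
    rw [div_mul_eq_mul_div, le_div_iff₀ hk2]
    linarith [hstab c, pos squareMeasure (Ux c), pos squareMeasure (Uy c)]
  have bUx : ∀ c, ∫ z, ‖Ux c z‖ ^ 2 ∂squareMeasure ≤ D * ∫ y, ‖S c y‖ ^ 2 ∂sideMeasure := by
    intro c
    linarith [hstab c, mul_nonneg hk2.le (pos squareMeasure (U c)), pos squareMeasure (Uy c)]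
  have bUy : ∀ c, ∫ z, ‖Uy c z‖ ^ 2 ∂squareMeasure ≤ D * ∫ y, ‖S c y‖ ^ 2 ∂sideMeasure := by
    intro c
    linarith [hstab c, mul_nonneg hk2.le (pos squareMeasure (U c)), pos squareMeasure (Ux c)]
  -- The trace inequality bounds the restriction to each side by the energy, hence by the data, so
  -- the traces converge along the same sequence.
  have bUs : ∀ (s : Side) c, ∫ y, ‖U c (s.point y)‖ ^ 2 ∂sideMeasure
      ≤ (2 * (D / k ^ 2) + D + D) * ∫ y, ‖S c y‖ ^ 2 ∂sideMeasure := by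
    intro s c
    have := integral_norm_trace_sq_le (hU c) s
    simp only [(dU c _).1, (dU c _).2] at this
    linarith [bU c, bUx c, bUy c]
  have hSsub : ∀ c d y, S (c - d) y = S c y - S d y := fun c d y => sideSum_sub c d _ y
  have hUsub : ∀ c d z, U (c - d) z = U c z - U d z := fun c d z => modeSum_sub c d _ _ z
  have hc' : ∀ j, √(∫ y, ‖S (c j) y - g y‖ ^ 2 ∂sideMeasure) ≤ (1 / 2) ^ j := fun j => (hc j).le
  obtain ⟨u, hu, tu⟩ := exists_limit_of_bounded mU mS hUsub hSsub bU hg hc'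
  obtain ⟨ux, hux, tux⟩ := exists_limit_of_bounded mUx mS (fun c d z => modeSum_sub c d _ _ z)
    hSsub bUx hg hc'
  obtain ⟨uy, huy, tuy⟩ := exists_limit_of_bounded mUy mS (fun c d z => modeSum_sub c d _ _ z)
    hSsub bUy hg hc'
  choose t ht tt using fun s => exists_limit_of_bounded (mUs s) mS
    (fun c d y => hUsub c d (s.point y)) hSsub (bUs s) hg hc'
  have tS : Tendsto (fun j => eLpNorm (fun y => S (c j) y - g y) 2 sideMeasure) atTop (𝓝 0) := by
    have e : ∀ j, eLpNorm (fun y => S (c j) y - g y) 2 sideMeasure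
        = ENNReal.ofReal √(∫ y, ‖S (c j) y - g y‖ ^ 2 ∂sideMeasure) := fun j =>
      eLpNorm_two_eq_ofReal_sqrt ((mS (c j)).sub hg)
    simp only [e]
    rw [← ENNReal.ofReal_zero]
    refine ENNReal.tendsto_ofReal (squeeze_zero (fun _ => Real.sqrt_nonneg _) hc' ?_)
    exact tendsto_pow_atTop_nhds_zero_of_lt_one (by norm_num) (by norm_num)
  have hH1 : MemH1 u ux uy := by
    refine ⟨hu, hux, huy, fun φ hφ hφc hφs => ?_⟩
    have mφ := hφ.continuous.memLp_squareMeasure (p := 2)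
    have mφ' := fun e => (hφ.continuous_fderiv_dir e).memLp_squareMeasure (p := 2)
    constructor
    · refine tendsto_nhds_unique (tendsto_integral_mul (fun j => mU (c j)) hu (mφ' _) tu)
        ((tendsto_integral_mul (fun j => mUx (c j)) hux mφ tux).neg.congr fun j => ?_)
      rw [((hU (c j)).memH1.4 φ hφ hφc hφs).1]
      simp only [(dU _ _).1]
    · refine tendsto_nhds_unique (tendsto_integral_mul (fun j => mU (c j)) hu (mφ' _) tu)
        ((tendsto_integral_mul (fun j => mUy (c j)) huy mφ tuy).neg.congr fun j => ?_)
      rw [((hU (c j)).memH1.4 φ hφ hφc hφs).2]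
      simp only [(dU _ _).2]
  refine ⟨u, ux, uy, ⟨hH1, t, fun s => ⟨ht s, fun j => U (c j), fun j => hU _, tu, ?_, ?_, tt s⟩,
    fun s hs => ?_, ?_⟩, ?_⟩
  · simpa only [(dU _ _).1] using tux
  · simpa only [(dU _ _).2] using tuy
  -- On a Dirichlet side every approximant vanishes identically, hence so does the limiting trace.
  · have hz : ∀ j y, U (c j) (s.point y) = 0 := by
      intro j y
      have hbd := modeSum_boundary hα ha (c j) y
      cases s
      · exact hbd.2.2.1 hs
      · have := hbd.2.1
        rw [hs] at this
        exact this
      · exact hbd.2.2.2.2.1 hs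
      · rw [hB₄] at hs; cases hs
    have := tt s
    simp only [hz, zero_sub] at this
    have h0 := tendsto_nhds_unique this tendsto_const_nhds
    rw [show (fun y => -t s y) = -t s from rfl, eLpNorm_neg, eq_comm,
      eLpNorm_eq_zero_iff (ht s).1 (by norm_num)] at h0
    refine h0.trans ?_
    cases s
    · rfl
    · rfl
    · rfl
    · rw [hB₄] at hs; cases hs
  · intro v vx vy τ hv hτ hd
    have L1 := tendsto_integral_mul (fun j => mUx (c j)) hux hv.2.conj tux
    have L2 := tendsto_integral_mul (fun j => mUy (c j)) huy hv.3.conj tuy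
    have L3 := (tendsto_integral_mul (fun j => mU (c j)) hu hv.1.conj tu).const_mul ((k : ℂ) ^ 2)
    have L4 := tendsto_integral_mul (fun j => mUs .left (c j)) (ht .left) (hτ .left).1.conj
      (tt .left)
    have L5 : Tendsto (fun j => if B .right = .impedance then
        ∫ y, U (c j) (Side.point .right y) * conj (τ .right y) ∂sideMeasure else 0) atTop
        (𝓝 (if B .right = .impedance then
        ∫ y, t .right y * conj (τ .right y) ∂sideMeasure else 0)) := by
      split_ifs
      · exact tendsto_integral_mul (fun j => mUs .right (c j)) (ht .right) (hτ .right).1.conj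
          (tt .right)
      · exact tendsto_const_nhds
    have L6 := tendsto_integral_mul (fun j => mS (c j)) hg (hτ .left).1.conj tS
    have main := tendsto_nhds_unique ((L1.add L2).sub L3)
      (((((L5.add L4).const_mul (Complex.I * k)).add L6)).congr fun j =>
        (modeSum_weak hB₁ hB₃ hα ha (c j) hv hτ hd).symm)
    have n1 : B .bottom ≠ .impedance := by rcases hB₁ with h | h <;> rw [h] <;> decide
    have n3 : B .top ≠ .impedance := by rcases hB₃ with h | h <;> rw [h] <;> decide
    rw [Side.sum_univ, Side.sum_univ]
    simp only [n1, n3, hB₄, if_false, if_true, leftData, Pi.zero_apply, zero_mul, integral_zero,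
      ite_self, zero_add, reduceCtorEq]
    rw [integral_add_sub (hux.integrable_mul_two hv.2.conj) (huy.integrable_mul_two hv.3.conj)
      ((hu.const_mul _).integrable_mul_two hv.1.conj)]
    simp only [mul_assoc ((k : ℂ) ^ 2)]
    rw [integral_const_mul]
    linear_combination main
  · have sq : ∀ {β : Type} [MeasurableSpace β] (μ : Measure β) (f : β → ℂ),
        √(∫ z, ‖f z‖ ^ 2 ∂μ) ^ 2 = ∫ z, ‖f z‖ ^ 2 ∂μ := fun μ f => Real.sq_sqrt (pos μ f)
    have L1 := (tendsto_sqrt_integral_norm (fun j => mUx (c j)) hux tux).pow 2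
    have L2 := (tendsto_sqrt_integral_norm (fun j => mUy (c j)) huy tuy).pow 2
    have L3 := ((tendsto_sqrt_integral_norm (fun j => mU (c j)) hu tu).pow 2).const_mul (k ^ 2)
    have L4 := ((tendsto_sqrt_integral_norm (fun j => mS (c j)) hg tS).pow 2).const_mul D
    simp only [sq] at L1 L2 L3 L4
    exact le_of_tendsto_of_tendsto' ((L1.add L2).add L3) L4 fun j => hstab (c j)

/-! ### The theorem. -/

theorem mainTheorem2 (k : ℝ) (hk : 0 < k) (B : Side → BoundaryOperator)
    (hB₁ : B .bottom = .dirichlet ∨ B .bottom = .neumann)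
    (hB₃ : B .top = .dirichlet ∨ B .top = .neumann)
    (hB₂ : B .right = .dirichlet ∨ B .right = .neumann ∨ B .right = .impedance)
    (hB₄ : B .left = .impedance)
    (g₄ : ℝ → ℂ) (hg₄ : MemLp g₄ 2 sideMeasure) :
    (∃ u ux uy : ℝ × ℝ → ℂ, IsHelmholtzSolution k B 0 (leftData g₄) u ux uy) ∧
    (∀ u ux uy w wx wy : ℝ × ℝ → ℂ,
      IsHelmholtzSolution k B 0 (leftData g₄) u ux uy →
      IsHelmholtzSolution k B 0 (leftData g₄) w wx wy →
      u =ᵐ[squareMeasure] w) ∧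
    (∀ u ux uy : ℝ × ℝ → ℂ, IsHelmholtzSolution k B 0 (leftData g₄) u ux uy →
      √(∫ z, (‖ux z‖ ^ 2 + ‖uy z‖ ^ 2) ∂squareMeasure) + k * √(∫ z, ‖u z‖ ^ 2 ∂squareMeasure)
        ≤ √12 * max k 1 * √(∫ y, ‖g₄ y‖ ^ 2 ∂sideMeasure)) := by
  obtain ⟨w, wx, wy, hw, hle⟩ := exists_helmholtzSolution_le hk hB₁ hB₃ hB₄ hg₄
  refine ⟨⟨w, wx, wy, hw⟩, fun u ux uy w wx wy hu hw => hu.ae_eq hk hB₁ hB₃ hB₄ hw,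
    fun u ux uy hu => ?_⟩
  have h0 := hu.ae_eq hk hB₁ hB₃ hB₄ hw
  obtain ⟨h1, h2⟩ := hu.1.gradient_ae_eq hw.1 h0
  have e0 : ∫ z, ‖u z‖ ^ 2 ∂squareMeasure = ∫ z, ‖w z‖ ^ 2 ∂squareMeasure :=
    integral_congr_ae (h0.mono fun z hz => by simp only [hz])
  have e1 : ∫ z, (‖ux z‖ ^ 2 + ‖uy z‖ ^ 2) ∂squareMeasure
      = ∫ z, ‖wx z‖ ^ 2 ∂squareMeasure + ∫ z, ‖wy z‖ ^ 2 ∂squareMeasure := by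
    rw [← integral_add ((memLp_two_iff_integrable_sq_norm hw.1.2.1).1 hw.1.2)
      ((memLp_two_iff_integrable_sq_norm hw.1.3.1).1 hw.1.3)]
    refine integral_congr_ae ?_
    filter_upwards [h1, h2] with z hz hz'
    rw [hz, hz']
  rw [e0, e1]
  have p1 : 0 ≤ ∫ z, ‖wx z‖ ^ 2 ∂squareMeasure + ∫ z, ‖wy z‖ ^ 2 ∂squareMeasure :=
    add_nonneg (integral_nonneg fun _ => by positivity) (integral_nonneg fun _ => by positivity)
  have p2 : 0 ≤ ∫ z, ‖w z‖ ^ 2 ∂squareMeasure := integral_nonneg fun _ => by positivity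
  have p3 : 0 ≤ ∫ y, ‖g₄ y‖ ^ 2 ∂sideMeasure := integral_nonneg fun _ => by positivity
  refine abs_le_of_sq_le_sq' ?_ (by positivity) |>.2
  rw [mul_pow, mul_pow, Real.sq_sqrt (by norm_num), Real.sq_sqrt p3]
  have s1 := Real.sq_sqrt p1
  have s2 := Real.sq_sqrt p2
  -- `(a + b)² = 2(a² + b²) - (a - b)²` with `a = ‖∇w‖` and `b = k‖w‖`.
  nlinarith [sq_nonneg (√(∫ z, ‖wx z‖ ^ 2 ∂squareMeasure + ∫ z, ‖wy z‖ ^ 2 ∂squareMeasure)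
    - k * √(∫ z, ‖w z‖ ^ 2 ∂squareMeasure))]
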